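/- Let $G=(V,E)$ be a finite simple planar three-connected graph with more than four vertices, and let $\Gamma\subset V$ be the set of vertices of a face of $G$. For $S\subset V$ let $N_G(S)$ be the set of vertices adjacent to a vertex of $S$, let $G[S]$ be the induced subgraph, and let $d_\Gamma$ be the graph distance in $G[\Gamma]$. Put $|u|_G=\langle L_Gu,u\rangle^{1/2}=\big(\sum_{\{p,q\}\in E}(u(p)-u(q))^2\big)^{1/2}$ for $u\in\mathbb R^V$, where $L_G$ is the graph Laplacian, and let $\widetilde L\in\mathbb R^{\Gamma\times\Gamma}$ be the Laplacian of the complete graph on $\Gamma$ with weights $d_\Gamma(p,q)^{-2}$, i.e. $\langle\widetilde L\varphi,\varphi\rangle=\sum_{\{p,q\}\subset\Gamma,\,p\ne q}(\varphi(p)-\varphi(q))^2/d_\Gamma(p,q)^2$. Let $G_{k,\ell}=C_k\,\square\,P_\ell$ be the Cartesian product of the $k$-cycle and the $\ell$-vertex path, with vertices $(i,j)$, $1\le i\le k$, $1\le j\le\ell$, and let $G^*_{k,\ell}$ be obtained from it by adding all edges $\{(i,j),(i\pm1,j+1)\}$, $1\le j\le \ell-1$, with $i\pm1$ taken modulo $k$.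 A graph $H$ on the same vertices with $G_{k,\ell}\subset H\subset G^*_{k,\ell}$ is an $M$-aggregation of $(G,\Gamma)$ if there is a partition of $V$ into sets $a_{i,j}$ ($1\le i\le k$, $1\le j\le\ell$) and a (possibly empty) set $a_*$ such that 1. $G[a_{i,j}]$ is connected and $|a_{i,j}|\le M$ for all $i,j$; 2. $\Gamma\subset\bigcup_{i=1}^k a_{i,1}$, and $\Gamma\cap a_{i,1}\neq\emptyset$ for all $i$; 3. $N_G(a_*)\subset a_*\cup\bigcup_{i=1}^k a_{i,\ell}$; 4. for $(i_1,j_1)\ne(i_2,j_2)$, the pair $\{(i_1,j_1),(i_2,j_2)\}$ is an edge of $H$ if and only if some vertex of $a_{i_1,j_1}$ is adjacent in $G$ to some vertex of $a_{i_2,j_2}$. Let $k,\ell,c,M\in\mathbb N$ with $\ell\ge2$ and $4\ell<k<2c\ell$, and suppose that some $H$ with $G_{k,\ell}\subset H\subset G^*_{k,\ell}$ is an $M$-aggregation of $(G,\Gamma)$. Then for every $\varphi\in\mathbb R^{\Gamma}$ the minimum below is attained and $$\frac{1}{6M\sqrt{M+3}\,\max\{\sqrt{3c},2\pi\}}\,\langle\widetilde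 L\varphi,\varphi\rangle^{1/2}\;\le\;\min_{u|_\Gamma=\varphi}|u|_G\;\le\;28M^2\sqrt{3c+20}\,\langle\widetilde L\varphi,\varphi\rangle^{1/2}.$$ -/

import Mathlib

open scoped Matrix

namespace TraceGraph

section Planarity

variable {V : Type*}

/-- A rotation system (combinatorial embedding) of a simple graph: a permutation of the darts
(oriented edges) whose cycles are exactly the sets of darts leaving a common vertex, i.e. a cyclic
order of the edges around every vertex. -/
structure RotationSystem (G : SimpleGraph V) where
  next : Equiv.Perm G.Dart
  fst_next : ∀ d, (next d).fst = d.fst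
  sameCycle_of_fst_eq : ∀ d d' : G.Dart, d.fst = d'.fst → next.SameCycle d d'

/-- Reversal of darts. -/
def reverseDart (G : SimpleGraph V) : Equiv.Perm G.Dart :=
  SimpleGraph.Dart.symm_involutive.toPerm SimpleGraph.Dart.symm

namespace RotationSystem

variable {G : SimpleGraph V} (R : RotationSystem G)

/-- Face tracing: traverse the dart `u → v`, then continue with the dart that follows `v → u` in the
cyclic order around `v`. The orbits of this permutation are the faces of the embedding. -/
def facePerm : Equiv.Perm G.Dart := R.next * reverseDart G

/-- The faces of the embedding. -/
def Face : Type _ := Quotient (Equiv.Perm.SameCycle.setoid R.facePerm)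

/-- The rotation system is a planar embedding (of a connected graph): the surface obtained by gluing
a disc along every face is the sphere, that is, `|V| - |E| + |F| = 2`. -/
def IsPlanar : Prop :=
  Nat.card V + Nat.card R.Face = Nat.card G.edgeSet + 2

/-- `Γ` is the set of vertices incident with some face of the embedding. -/
def IsFaceVertexSet (Γ : Finset V) : Prop :=
  ∃ d : G.Dart, ∀ v, v ∈ Γ ↔ ∃ d', R.facePerm.SameCycle d d' ∧ d'.fst = v

end RotationSystem

/-- `G` remains connected upon the removal of any at most two vertices. -/
def IsThreeConnected (G : SimpleGraph V) : Prop :=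
  ∀ S : Finset V, S.card ≤ 2 → (G.induce {v | v ∉ S}).Connected

/-- The class of pairs `(G, Γ)` with `G` a planar three-connected graph with more than four vertices
and `Γ` the vertex set of some face of `G`. -/
def IsPlanarWithBoundary (G : SimpleGraph V) (Γ : Finset V) : Prop :=
  4 < Nat.card V ∧ IsThreeConnected G ∧
    ∃ R : RotationSystem G, R.IsPlanar ∧ R.IsFaceVertexSet Γ

end Planarity

section Grids

/-- `G_{k,ℓ} = C_k □ P_ℓ`. -/
def grid (k l : ℕ) : SimpleGraph (Fin k × Fin l) :=
  SimpleGraph.boxProd (SimpleGraph.cycleGraph k) (SimpleGraph.pathGraph l)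

/-- `G*_{k,ℓ}`: the graph `G_{k,ℓ}` with all the diagonal edges `{(i,j), (i ± 1, j + 1)}` added,
the first index being taken modulo `k`. -/
def gridStar (k l : ℕ) : SimpleGraph (Fin k × Fin l) where
  Adj x y := (grid k l).Adj x y ∨
    ((SimpleGraph.cycleGraph k).Adj x.1 y.1 ∧ (SimpleGraph.pathGraph l).Adj x.2 y.2)
  symm := ⟨fun _ _ h => h.imp (fun h => h.symm) (fun h => ⟨h.1.symm, h.2.symm⟩)⟩
  loopless := ⟨fun _ h => h.elim (fun h => h.ne rfl) (fun h => h.1.ne rfl)⟩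

end Grids

section Aggregation

variable {V : Type*}

/-- The sets `a (i, j)` and `aStar` form a partition of the vertices of `G` that exhibits `H` as an
`M`-aggregation of `(G, Γ)`. Indices start from `0`, so the first row is `j = 0` and the last one is
`j + 1 = l`. The set `aStar` may be empty. -/
structure IsAggregationPartition (G : SimpleGraph V) (Γ : Finset V) (M : ℕ) {k l : ℕ}
    (H : SimpleGraph (Fin k × Fin l)) (a : Fin k × Fin l → Finset V) (aStar : Finset V) :
    Prop where
  disjoint : ∀ x y, x ≠ y → Disjoint (a x) (a y)
  disjoint_star : ∀ x, Disjoint (a x) aStar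
  cover : ∀ v, v ∈ aStar ∨ ∃ x, v ∈ a x
  connected : ∀ x, (G.induce {v | v ∈ a x}).Connected
  card_le : ∀ x, (a x).card ≤ M
  boundary_subset : ∀ v ∈ Γ, ∃ (i : Fin k) (j : Fin l), (j : ℕ) = 0 ∧ v ∈ a (i, j)
  boundary_meets : ∀ (i : Fin k) (j : Fin l), (j : ℕ) = 0 → ∃ v ∈ Γ, v ∈ a (i, j)
  star_neighbors : ∀ v ∈ aStar, ∀ w, G.Adj v w →
    w ∈ aStar ∨ ∃ (i : Fin k) (j : Fin l), (j : ℕ) + 1 = l ∧ w ∈ a (i, j)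
  adj_iff : ∀ x y, x ≠ y → (H.Adj x y ↔ ∃ v ∈ a x, ∃ w ∈ a y, G.Adj v w)

/-- `H`, with `G_{k,ℓ} ⊆ H ⊆ G*_{k,ℓ}`, is an `M`-aggregation of `(G, Γ)`. -/
def IsMAggregation (G : SimpleGraph V) (Γ : Finset V) (M : ℕ) {k l : ℕ}
    (H : SimpleGraph (Fin k × Fin l)) : Prop :=
  grid k l ≤ H ∧ H ≤ gridStar k l ∧
    ∃ (a : Fin k × Fin l → Finset V) (aStar : Finset V), IsAggregationPartition G Γ M H a aStar

end Aggregation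

noncomputable section Energies

/-- The energy semi-norm `|u|_G = ⟨L_G u, u⟩^{1/2}`. -/
def energy {V : Type*} [Fintype V] [DecidableEq V] (G : SimpleGraph V) [DecidableRel G.Adj]
    (u : V → ℝ) : ℝ :=
  √((G.lapMatrix ℝ *ᵥ u) ⬝ᵥ u)

/-- The Laplacian of the complete graph on `ι` with edge weights `w`. -/
def weightedLaplacian {ι : Type*} [Fintype ι] [DecidableEq ι] (w : ι → ι → ℝ) : Matrix ι ι ℝ :=
  Matrix.of fun i j => if i = j then ∑ m ∈ Finset.univ.erase i, w i m else -w i j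

/-- `L̃`: the Laplacian of the complete graph on `Γ` with weights `d_Γ(i,j)^{-2}`, where `d_Γ` is the
distance in the induced graph `G[Γ]`. -/
def boundaryLaplacian {V : Type*} [DecidableEq V] (G : SimpleGraph V) (Γ : Finset V) :
    Matrix {v // v ∈ Γ} {v // v ∈ Γ} ℝ :=
  weightedLaplacian fun p q => ((((G.induce {v | v ∈ Γ}).dist p q : ℕ) : ℝ) ^ 2)⁻¹

end Energies

end TraceGraph

/-!
Lower bound. By Euler's formula the functions on faces account for all circulations on a connected
planar map: a circulation is the rotated gradient of a potential on the faces. Sending one unit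
along a face and back through a connected set `A` gives a potential that a connected set disjoint
from `A` cannot cross, so two disjoint connected sets do not interlace along a face. Hence the
vertices of `Γ` between two given columns lie on an arc of the face, and `d_Γ` is comparable, up to
a factor `M`, with the cyclic distance of columns. On the cylinder, the increment of a function at
distance `d + 1` along the first row is read off the row `d % l` instead; Hardy's inequality
controls the vertical error. This trace inequality is applied to the values of `u` at one
representative per block.

Upper bound. The values of `φ` at one representative per column are extended to the cylinder by
their means over windows of growing width, interpolated to a constant on the last row; the constant
is continued over `a_*`. The extension is then pulled back to the blocks and corrected on `Γ`.
-/

namespace TraceGraph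

section ReachableIn

variable {V : Type*} {G : SimpleGraph V} {S T : Set V} {u v w : V}

/-- `v` and `w` are joined by a walk of `G` inside `S`; in particular both belong to `S`. -/
def ReachableIn (G : SimpleGraph V) (S : Set V) (v w : V) : Prop :=
  ∃ (hv : v ∈ S) (hw : w ∈ S), (G.induce S).Reachable ⟨v, hv⟩ ⟨w, hw⟩

namespace ReachableIn

lemma refl (hv : v ∈ S) : ReachableIn G S v v := ⟨hv, hv, .refl _⟩

lemma symm (h : ReachableIn G S v w) : ReachableIn G S w v :=
  let ⟨hv, hw, h⟩ := h
  ⟨hw, hv, h.symm⟩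

lemma trans (h : ReachableIn G S u v) (h' : ReachableIn G S v w) : ReachableIn G S u w :=
  let ⟨hu, _, h⟩ := h
  let ⟨_, hw, h'⟩ := h'
  ⟨hu, hw, h.trans h'⟩

lemma of_adj (h : G.Adj v w) (hv : v ∈ S) (hw : w ∈ S) : ReachableIn G S v w :=
  ⟨hv, hw, SimpleGraph.Adj.reachable (G := G.induce S) (u := ⟨v, hv⟩) (v := ⟨w, hw⟩) h⟩

lemma mono (hST : S ⊆ T) (h : ReachableIn G S v w) : ReachableIn G T v w :=
  let ⟨hv, hw, h⟩ := h
  ⟨hST hv, hST hw, h.map (G.induceHomOfLE hST).toHom⟩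

lemma of_preconnected (h : (G.induce S).Preconnected) (hv : v ∈ S) (hw : w ∈ S) :
    ReachableIn G S v w :=
  ⟨hv, hw, h _ _⟩

lemma of_reachable (h : G.Reachable v w) : ReachableIn G Set.univ v w :=
  ⟨trivial, trivial, (SimpleGraph.induceUnivIso G).reachable_iff.1 h⟩

@[elab_as_elim]
lemma head_induction_on {motive : V → Prop} (h : ReachableIn G S v w) (refl : motive w)
    (head : ∀ x y, x ∈ S → y ∈ S → G.Adj x y → ReachableIn G S y w → motive y → motive x) :
    motive v := by
  obtain ⟨hv, hw, ⟨p⟩⟩ := h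
  suffices ∀ x y : S, (G.induce S).Walk x y → motive y → ReachableIn G S y w → motive x from
    this _ _ p refl (.refl hw)
  intro x y p hy hyw
  induction p with
  | nil => exact hy
  | @cons x z y hxz p ih =>
    exact head x z x.2 z.2 hxz (trans ⟨z.2, y.2, ⟨p⟩⟩ hyw) (ih hy hyw)

lemma dist_lt_card {S Γ : Finset V} (hS : S ⊆ Γ) (h : ReachableIn G {v | v ∈ S} v w)
    (hv : v ∈ Γ) (hw : w ∈ Γ) :
    (G.induce {v | v ∈ Γ}).dist ⟨v, hv⟩ ⟨w, hw⟩ < S.card := by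
  obtain ⟨_, _, h⟩ := h
  obtain ⟨p, hp⟩ := h.exists_isPath
  have hsub : {v | v ∈ S} ⊆ {v | v ∈ Γ} := fun _ hx => hS hx
  calc (G.induce {v | v ∈ Γ}).dist ⟨v, hv⟩ ⟨w, hw⟩
      ≤ (p.map (G.induceHomOfLE hsub).toHom).length := SimpleGraph.dist_le _
    _ = p.length := SimpleGraph.Walk.length_map _ _
    _ < Fintype.card {v | v ∈ S} := hp.length_lt
    _ = S.card := by simp

end ReachableIn

end ReachableIn

section Flows

variable {V : Type*} {G : SimpleGraph V}

variable (G) in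
/-- Flows along the edges of `G`: real functions on darts that change sign under reversal. -/
def flows : Submodule ℝ (G.Dart → ℝ) where
  carrier := {f | ∀ d, f d.symm = -f d}
  add_mem' hf hg d := by simp only [Pi.add_apply, hf d, hg d, neg_add]
  zero_mem' d := by simp
  smul_mem' r f hf d := by simp only [Pi.smul_apply, hf d, smul_neg]

/-- The flow that carries `g d` units along every dart `d`, flows along opposite darts cancelling
each other. -/
def netFlow : (G.Dart → ℝ) →ₗ[ℝ] G.Dart → ℝ :=
  LinearMap.id - LinearMap.funLeft ℝ ℝ SimpleGraph.Dart.symm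

@[simp]
lemma netFlow_apply (g : G.Dart → ℝ) (d : G.Dart) : netFlow g d = g d - g d.symm := rfl

lemma netFlow_mem_flows (g : G.Dart → ℝ) : netFlow g ∈ flows G := fun d => by simp

lemma finrank_flows_le [Finite V] : Module.finrank ℝ (flows G) ≤ Nat.card G.edgeSet := by
  have := Fintype.ofFinite G.edgeSet
  have hdart (e : G.edgeSet) : ∃ d : G.Dart, d.edge = e := by
    obtain ⟨⟨x, y⟩, he⟩ := e
    exact ⟨⟨(x, y), he⟩, rfl⟩
  choose orient horient using hdart
  let restrict : flows G →ₗ[ℝ] G.edgeSet → ℝ := LinearMap.funLeft ℝ ℝ orient ∘ₗ (flows G).subtype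
  have hinj : Function.Injective restrict := by
    refine (injective_iff_map_eq_zero _).2 fun f hf => Subtype.ext (funext fun d => ?_)
    have hd : f.1 (orient ⟨d.edge, d.edge_mem⟩) = 0 := congrFun hf _
    rcases (SimpleGraph.dart_edge_eq_iff _ _).1 (horient ⟨d.edge, d.edge_mem⟩) with h | h
    · rwa [h] at hd
    · rwa [h, f.2, neg_eq_zero] at hd
  simpa [Nat.card_eq_fintype_card] using LinearMap.finrank_le_finrank_of_injective hinj

variable [Fintype V] [DecidableRel G.Adj]

lemma sum_comp_symm (g : G.Dart → ℝ) : ∑ d : G.Dart, g d.symm = ∑ d, g d :=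
  Equiv.sum_comp (reverseDart G) g

variable [DecidableEq V]

/-- The net amount that leaves each vertex. -/
def divergence : (G.Dart → ℝ) →ₗ[ℝ] V → ℝ where
  toFun f v := ∑ d with d.fst = v, f d
  map_add' _ _ := funext fun _ => Finset.sum_add_distrib
  map_smul' _ _ := funext fun _ => (Finset.mul_sum _ _ _).symm

lemma divergence_apply (f : G.Dart → ℝ) (v : V) : divergence f v = ∑ d with d.fst = v, f d := rfl

lemma sum_fst_mul (p : V → ℝ) (f : G.Dart → ℝ) :
    ∑ d : G.Dart, p d.fst * f d = ∑ v, p v * divergence f v := by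
  rw [← Finset.sum_fiberwise Finset.univ fun d : G.Dart => d.fst]
  refine Finset.sum_congr rfl fun v _ => ?_
  rw [divergence_apply, Finset.mul_sum]
  exact Finset.sum_congr rfl fun d hd => by rw [(Finset.mem_filter.1 hd).2]

/-- Summation by parts: the gradient is, up to a factor, the adjoint of the divergence. -/
lemma sum_netFlow_snd_mul {f : G.Dart → ℝ} (hf : f ∈ flows G) (p : V → ℝ) :
    ∑ d, netFlow (fun d => p d.snd) d * f d = -2 * ∑ v, p v * divergence f v := by
  have hsnd : ∑ d : G.Dart, p d.snd * f d = -∑ d : G.Dart, p d.fst * f d := by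
    rw [← sum_comp_symm, ← Finset.sum_neg_distrib]
    exact Finset.sum_congr rfl fun d _ => by rw [hf, mul_neg]; rfl
  calc ∑ d, netFlow (fun d => p d.snd) d * f d
      = ∑ d : G.Dart, p d.snd * f d - ∑ d : G.Dart, p d.fst * f d := by
        simp only [netFlow_apply, sub_mul, Finset.sum_sub_distrib]; rfl
    _ = -2 * ∑ v, p v * divergence f v := by rw [hsnd, sum_fst_mul]; ring

lemma divergence_netFlow_single (e : G.Dart) :
    divergence (netFlow (Pi.single e 1)) = Pi.single e.fst 1 - Pi.single e.snd 1 := by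
  ext v
  have hsymm (d : G.Dart) : d.symm = e ↔ d = e.symm := SimpleGraph.Dart.symm_involutive.eq_iff
  simp only [divergence_apply, netFlow_apply, Pi.single_apply, hsymm, Finset.sum_sub_distrib,
    Finset.sum_ite_eq', Finset.mem_filter, Finset.mem_univ, true_and, Pi.sub_apply,
    eq_comm (a := v)]
  rfl

/-- Push one unit along a walk inside `A`. -/
lemma ReachableIn.exists_flow {A : Set V} {v w : V} (h : ReachableIn G A v w) :
    ∃ f ∈ flows G, (∀ d : G.Dart, d.fst ∉ A → f d = 0) ∧
      divergence f = Pi.single v 1 - Pi.single w 1 := by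
  refine h.head_induction_on ⟨0, zero_mem _, fun _ _ => rfl, by rw [map_zero, sub_self]⟩ ?_
  rintro x y hx hy hxy - ⟨f, hf, hfA, hdiv⟩
  let e : G.Dart := ⟨(x, y), hxy⟩
  refine ⟨netFlow (Pi.single e 1) + f, add_mem (netFlow_mem_flows _) hf, fun d hd => ?_, ?_⟩
  · have hde : d ≠ e := fun h => hd (h ▸ hx)
    have hds : d.symm ≠ e := fun h => hd (h ▸ hy : d.symm.snd ∈ A)
    simp [hde, hds, hfA d hd]
  · rw [map_add, divergence_netFlow_single, hdiv, sub_add_sub_cancel]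

end Flows

namespace RotationSystem

variable {V : Type*} {G : SimpleGraph V} (R : RotationSystem G)

lemma facePerm_symm (d : G.Dart) : R.facePerm d.symm = R.next d :=
  congrArg R.next d.symm_symm

lemma fst_facePerm (d : G.Dart) : (R.facePerm d).fst = d.snd := R.fst_next d.symm

/-- The face traced by a dart. -/
def faceOf (d : G.Dart) : R.Face := Quotient.mk _ d

@[simp]
lemma faceOf_facePerm (d : G.Dart) : R.faceOf (R.facePerm d) = R.faceOf d :=
  Quotient.sound (Equiv.Perm.sameCycle_apply_left.2 (Equiv.Perm.SameCycle.refl _ _))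

lemma faceOf_iterate (d : G.Dart) (t : ℕ) : R.faceOf (R.facePerm^[t] d) = R.faceOf d := by
  induction t with
  | zero => rfl
  | succ t ih => rw [Function.iterate_succ_apply', faceOf_facePerm, ih]

lemma faceOf_next (d : G.Dart) : R.faceOf (R.next d) = R.faceOf d.symm := by
  rw [← facePerm_symm, faceOf_facePerm]

lemma eq_of_fst_eq {α : Type*} (g : G.Dart → α) {d d' : G.Dart}
    (hnext : ∀ e : G.Dart, e.fst = d.fst → g (R.next e) = g e) (h : d.fst = d'.fst) :
    g d = g d' := by
  obtain ⟨n, rfl⟩ := R.sameCycle_of_fst_eq d d' h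
  have hstep (e : G.Dart) :
      (R.next e).fst = d.fst ∧ g d = g (R.next e) ↔ e.fst = d.fst ∧ g d = g e := by
    rw [R.fst_next]
    exact and_congr_right fun he => by rw [hnext e he]
  have hpow (n : ℤ) : ((R.next ^ n) d).fst = d.fst ∧ g d = g ((R.next ^ n) d) := by
    induction n using Int.induction_on with
    | zero => exact ⟨rfl, rfl⟩
    | succ n ih => rwa [add_comm, zpow_one_add, Equiv.Perm.mul_apply, hstep]
    | pred n ih =>
      rwa [← hstep, ← Equiv.Perm.mul_apply, ← zpow_one_add, add_sub_cancel]
  exact (hpow n).2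

lemma eq_of_reachableIn {α : Type*} (g : G.Dart → α) {B : Set V}
    (hnext : ∀ d : G.Dart, d.fst ∈ B → g (R.next d) = g d)
    (hsymm : ∀ d : G.Dart, d.fst ∈ B → d.snd ∈ B → g d.symm = g d)
    {d d' : G.Dart} (h : ReachableIn G B d.fst d'.fst) : g d = g d' := by
  suffices ∀ v, ReachableIn G B v d'.fst → ∀ d : G.Dart, d.fst = v → g d = g d' from this _ h d rfl
  intro v hv
  refine hv.head_induction_on (fun d hd => ?_) fun x y hx hy hxy _ ih d hd => ?_
  · obtain ⟨-, hB, -⟩ := hv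
    exact R.eq_of_fst_eq g (fun e he => hnext e (by rwa [he, hd])) hd
  · let e : G.Dart := ⟨(x, y), hxy⟩
    calc g d = g e := R.eq_of_fst_eq g (fun e he => hnext e (by rwa [he, hd])) hd
      _ = g e.symm := (hsymm e hx hy).symm
      _ = g d' := ih e.symm rfl

lemma divergence_netFlow_faceOf [Fintype V] [DecidableEq V] [DecidableRel G.Adj]
    (q : R.Face → ℝ) : divergence (netFlow (q ∘ R.faceOf)) = 0 := by
  ext v
  have hnext : ∑ d : G.Dart with d.fst = v, q (R.faceOf (R.next d)) =
      ∑ d : G.Dart with d.fst = v, q (R.faceOf d) :=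
    Finset.sum_equiv R.next (fun d => by simp [R.fst_next]) fun _ _ => rfl
  simp only [divergence_apply, netFlow_apply, Function.comp_apply, Finset.sum_sub_distrib,
    ← faceOf_next, hnext, sub_self, Pi.zero_apply]

section Potential

/-- The sum of the gradient of a function on vertices and the rotated gradient of a function on
faces. This is the discrete Hodge decomposition; on the sphere there is no harmonic part. -/
def hodgeMap : (V → ℝ) × (R.Face → ℝ) →ₗ[ℝ] G.Dart → ℝ :=
  netFlow ∘ₗ (LinearMap.funLeft ℝ ℝ fun d : G.Dart => d.snd).coprod
    (LinearMap.funLeft ℝ ℝ R.faceOf)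

lemma hodgeMap_eq (p : V → ℝ) (q : R.Face → ℝ) :
    R.hodgeMap (p, q) = netFlow (fun d => p d.snd) + netFlow (q ∘ R.faceOf) := by
  simp only [hodgeMap, LinearMap.comp_apply, LinearMap.coprod_apply, map_add]
  rfl

lemma eq_of_netFlow_snd_eq_zero (hG : G.Preconnected) {p : V → ℝ}
    (hp : netFlow (G := G) (fun d => p d.snd) = 0) (v w : V) : p v = p w := by
  refine (ReachableIn.of_reachable (hG v w)).head_induction_on rfl fun x y _ _ hxy _ ih => ?_
  exact (sub_eq_zero.1 (congrFun hp ⟨(x, y), hxy⟩)).symm.trans ih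

lemma eq_of_netFlow_faceOf_eq_zero (hG : G.Preconnected) {q : R.Face → ℝ}
    (hq : netFlow (q ∘ R.faceOf) = 0) (F F' : R.Face) : q F = q F' := by
  have hsymm (d : G.Dart) : q (R.faceOf d.symm) = q (R.faceOf d) :=
    (sub_eq_zero.1 (congrFun hq d)).symm
  induction F, F' using Quotient.inductionOn₂ with
  | h d d' =>
    exact R.eq_of_reachableIn (fun d => q (R.faceOf d))
      (fun d _ => by rw [faceOf_next, hsymm]) (fun d _ _ => hsymm d) (.of_reachable (hG _ _))

lemma netFlow_snd_eq_zero_of_divergence_hodgeMap [Fintype V] [DecidableEq V] [DecidableRel G.Adj]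
    {p : V → ℝ} {q : R.Face → ℝ}
    (h : divergence (R.hodgeMap (p, q)) = 0) : netFlow (G := G) (fun d => p d.snd) = 0 := by
  rw [hodgeMap_eq, map_add, divergence_netFlow_faceOf, add_zero] at h
  have hsq : ∑ d : G.Dart, netFlow (fun d => p d.snd) d * netFlow (fun d => p d.snd) d = 0 := by
    rw [sum_netFlow_snd_mul (netFlow_mem_flows _), h]
    simp
  have := (Finset.sum_eq_zero_iff_of_nonneg fun d _ => mul_self_nonneg _).1 hsq
  exact funext fun d => mul_self_eq_zero.1 (this d (Finset.mem_univ d))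

lemma finrank_ker_hodgeMap_le [Finite V] (hG : G.Preconnected) (d : G.Dart) :
    Module.finrank ℝ (LinearMap.ker R.hodgeMap) ≤ 2 := by
  classical
  have := Fintype.ofFinite V
  let eval : LinearMap.ker R.hodgeMap →ₗ[ℝ] ℝ × ℝ :=
    ((LinearMap.proj d.fst).prodMap (LinearMap.proj (R.faceOf d))) ∘ₗ Submodule.subtype _
  have heval : Function.Injective eval := by
    refine (injective_iff_map_eq_zero _).2 ?_
    rintro ⟨⟨p, q⟩, hpq⟩ h
    have hp : p d.fst = 0 := congrArg Prod.fst h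
    have hq : q (R.faceOf d) = 0 := congrArg Prod.snd h
    have hker : R.hodgeMap (p, q) = 0 := LinearMap.mem_ker.1 hpq
    have hgrad := R.netFlow_snd_eq_zero_of_divergence_hodgeMap (by rw [hker, map_zero])
    rw [hodgeMap_eq, hgrad, zero_add] at hker
    refine Subtype.ext (Prod.ext (funext fun v => ?_) (funext fun F => ?_))
    · exact (eq_of_netFlow_snd_eq_zero hG hgrad v d.fst).trans hp
    · exact (R.eq_of_netFlow_faceOf_eq_zero hG hker F (R.faceOf d)).trans hq
  simpa using LinearMap.finrank_le_finrank_of_injective heval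

/-- Rank and nullity, with Euler's formula for the dimensions. -/
lemma IsPlanar.range_hodgeMap [Finite V] {R : RotationSystem G} (hR : R.IsPlanar)
    (hG : G.Preconnected) (d : G.Dart) : LinearMap.range R.hodgeMap = flows G := by
  classical
  have := Fintype.ofFinite V
  have : Finite R.Face := Quotient.finite _
  have := Fintype.ofFinite R.Face
  have hle : LinearMap.range R.hodgeMap ≤ flows G := by
    rintro - ⟨q, rfl⟩
    exact netFlow_mem_flows _
  refine Submodule.eq_of_le_of_finrank_le hle (finrank_flows_le.trans ?_)
  have hrank := LinearMap.finrank_range_add_finrank_ker R.hodgeMap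
  have hker := R.finrank_ker_hodgeMap_le hG d
  have heuler : Nat.card V + Nat.card R.Face = Nat.card G.edgeSet + 2 := hR
  rw [Module.finrank_prod, Module.finrank_fintype_fun_eq_card,
    Module.finrank_fintype_fun_eq_card] at hrank
  simp only [Nat.card_eq_fintype_card (α := V), Nat.card_eq_fintype_card (α := R.Face)] at heuler
  omega

theorem IsPlanar.exists_potential [Fintype V] [DecidableEq V] [DecidableRel G.Adj]
    {R : RotationSystem G} (hR : R.IsPlanar) (hG : G.Preconnected) {f : G.Dart → ℝ}
    (hf : f ∈ flows G) (hdiv : divergence f = 0) :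
    ∃ q : R.Face → ℝ, f = netFlow (q ∘ R.faceOf) := by
  rcases isEmpty_or_nonempty G.Dart with _ | ⟨⟨d⟩⟩
  · exact ⟨0, Subsingleton.elim _ _⟩
  rw [← hR.range_hodgeMap hG d] at hf
  obtain ⟨⟨p, q⟩, rfl⟩ := hf
  exact ⟨q, by rw [hodgeMap_eq, R.netFlow_snd_eq_zero_of_divergence_hodgeMap hdiv, zero_add]⟩

end Potential

section Noncrossing

/-- The number of times the first `s` steps of the face tracing from `d` pass along a dart. -/
def passages [DecidableEq V] (d : G.Dart) (s : ℕ) : G.Dart → ℝ :=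
  ∑ i ∈ Finset.range s, Pi.single (R.facePerm^[i] d) 1

lemma passages_apply [DecidableEq V] (d : G.Dart) (s : ℕ) (x : G.Dart) :
    R.passages d s x = ∑ i ∈ Finset.range s, if x = R.facePerm^[i] d then 1 else 0 := by
  simp only [passages, Finset.sum_apply, Pi.single_apply]

lemma passages_iterate [DecidableEq V] {d : G.Dart} {s r : ℕ}
    (hs : s ≤ Function.minimalPeriod R.facePerm d)
    (hr : r < Function.minimalPeriod R.facePerm d) :
    R.passages d s (R.facePerm^[r] d) = if r < s then 1 else 0 := by
  have hinj : ∀ i ∈ Finset.range s, (R.facePerm^[r] d = R.facePerm^[i] d ↔ r = i) := fun i hi =>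
    Function.iterate_injOn_Iio_minimalPeriod.eq_iff hr ((Finset.mem_range.1 hi).trans_le hs)
  rw [passages_apply, Finset.sum_congr rfl fun i hi => if_congr (hinj i hi) rfl rfl,
    Finset.sum_ite_eq]
  simp only [Finset.mem_range]

lemma passages_facePerm [DecidableEq V] {d x : G.Dart} {s : ℕ} (h₀ : R.facePerm x ≠ d)
    (hs : R.facePerm x ≠ R.facePerm^[s] d) :
    R.passages d s (R.facePerm x) = R.passages d s x := by
  have hsucc : R.passages d s x =
      ∑ i ∈ Finset.range s, if R.facePerm x = R.facePerm^[i + 1] d then 1 else 0 := by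
    simp only [passages_apply, Function.iterate_succ_apply', R.facePerm.injective.eq_iff]
  have htel := Finset.sum_range_sub
    (fun i => if R.facePerm x = R.facePerm^[i] d then (1 : ℝ) else 0) s
  rw [Finset.sum_sub_distrib, ← hsucc, ← passages_apply, if_neg hs, Function.iterate_zero_apply,
    if_neg h₀, sub_self, sub_eq_zero] at htel
  exact htel.symm

lemma divergence_netFlow_passages [Fintype V] [DecidableEq V] [DecidableRel G.Adj] (d : G.Dart)
    (s : ℕ) :
    divergence (netFlow (R.passages d s)) =
      Pi.single d.fst 1 - Pi.single (R.facePerm^[s] d).fst 1 := by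
  have hsnd (i : ℕ) : (R.facePerm^[i] d).snd = (R.facePerm^[i + 1] d).fst := by
    rw [Function.iterate_succ_apply', fst_facePerm]
  simp only [passages, map_sum, divergence_netFlow_single, hsnd]
  exact Finset.sum_range_sub' (fun i => (Pi.single (R.facePerm^[i] d).fst 1 : V → ℝ)) s

/-- Close the arc of the face from `d` to `R.facePerm^[s] d` by a flow inside `A`, and let `q` be a
potential of the circulation so obtained. Turning around the vertices of `B`, which this circulation
meets only along the face, `q` minus the number of passages stays constant; but it takes different
values at the two vertices of `B`, which lie on different sides of `A` on the face. -/
theorem IsPlanar.noncrossing [Finite V] {R : RotationSystem G} (hR : R.IsPlanar)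
    (hG : G.Preconnected) {d : G.Dart} {r s t : ℕ} (hr : r < s) (hs : s ≤ t)
    (ht : t < Function.minimalPeriod R.facePerm d) {A B : Set V} (hAB : Disjoint A B)
    (hA : ReachableIn G A d.fst (R.facePerm^[s] d).fst) :
    ¬ReachableIn G B (R.facePerm^[r] d).fst (R.facePerm^[t] d).fst := by
  classical
  have := Fintype.ofFinite V
  intro hB
  obtain ⟨f, hf, hfA, hdiv⟩ := hA.symm.exists_flow
  obtain ⟨q, hq⟩ := hR.exists_potential hG (add_mem (netFlow_mem_flows (R.passages d s)) hf) (by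
    rw [map_add, divergence_netFlow_passages, hdiv, sub_add_sub_cancel, sub_self])
  have hnotB {x : G.Dart} (hx : x.fst ∈ A) : x.fst ∉ B := Set.disjoint_left.1 hAB hx
  obtain ⟨hA₀, hA₁, -⟩ := hA
  have hpass (x : G.Dart) (hx : x.fst ∈ B) :
      R.passages d s (R.next x) = R.passages d s x.symm := by
    rw [← R.facePerm_symm]
    have hx' : (R.facePerm x.symm).fst ∈ B := by rwa [facePerm_symm, R.fst_next]
    exact R.passages_facePerm (fun h => hnotB hA₀ (h ▸ hx')) fun h => hnotB hA₁ (h ▸ hx')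
  have hjump (x : G.Dart) (hx : x.fst ∈ B) : q (R.faceOf x.symm) - R.passages d s x.symm =
      q (R.faceOf x) - R.passages d s x := by
    have := congrFun hq x
    simp only [Pi.add_apply, netFlow_apply, hfA x (Set.disjoint_right.1 hAB hx),
      Function.comp_apply] at this
    linarith
  have hconst := R.eq_of_reachableIn (fun x => q (R.faceOf x) - R.passages d s x)
    (fun x hx => by simp only [faceOf_next, hpass x hx, hjump x hx]) (fun x hx _ => hjump x hx) hB
  simp only [faceOf_iterate, R.passages_iterate (hs.trans ht.le) (hr.trans_le hs |>.trans ht),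
    R.passages_iterate (hs.trans ht.le) ht, if_pos hr, if_neg hs.not_gt] at hconst
  linarith

end Noncrossing

end RotationSystem

section FaceTour

variable {V : Type*} {G : SimpleGraph V} {R : RotationSystem G} {Γ : Finset V}

lemma exists_iterate_eq_of_sameCycle {α : Type*} [Finite α] {f : Equiv.Perm α} {x y : α}
    (h : f.SameCycle x y) : ∃ t < Function.minimalPeriod f x, f^[t] x = y := by
  obtain ⟨t, -, -, rfl⟩ := h.exists_pow_eq''
  have hpos : 0 < Function.minimalPeriod f x :=
    Function.minimalPeriod_pos_of_mem_periodicPts (f.injective.mem_periodicPts x)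
  exact ⟨t % Function.minimalPeriod f x, Nat.mod_lt _ hpos, by
    rw [Function.iterate_mod_minimalPeriod_eq, Equiv.Perm.iterate_eq_pow]⟩

namespace RotationSystem

lemma adj_iterate_facePerm (R : RotationSystem G) (d : G.Dart) (t : ℕ) :
    G.Adj (R.facePerm^[t] d).fst (R.facePerm^[t + 1] d).fst := by
  rw [Function.iterate_succ_apply', R.fst_facePerm]
  exact (R.facePerm^[t] d).adj

lemma reachableIn_iterate (R : RotationSystem G) (d : G.Dart) {S : Set V} {s t : ℕ} (hst : s ≤ t)
    (h : ∀ r, s ≤ r → r ≤ t → (R.facePerm^[r] d).fst ∈ S) :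
    ReachableIn G S (R.facePerm^[s] d).fst (R.facePerm^[t] d).fst := by
  induction t, hst using Nat.le_induction with
  | base => exact .refl (h s le_rfl le_rfl)
  | succ t hst ih =>
    exact (ih fun r h₁ h₂ => h r h₁ (h₂.trans t.le_succ)).trans
      (.of_adj (R.adj_iterate_facePerm d t) (h t hst t.le_succ) (h _ (hst.trans t.le_succ) le_rfl))

lemma IsFaceVertexSet.exists_tour [Finite V] (hΓ : R.IsFaceVertexSet Γ) {p q : V} (hp : p ∈ Γ)
    (hq : q ∈ Γ) :
    ∃ d : G.Dart, (∀ t, (R.facePerm^[t] d).fst ∈ Γ) ∧ d.fst = p ∧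
      ∃ t < Function.minimalPeriod R.facePerm d, (R.facePerm^[t] d).fst = q := by
  classical
  have := Fintype.ofFinite V
  obtain ⟨d₀, hd₀⟩ := hΓ
  obtain ⟨d, hd, hdp⟩ := (hd₀ p).1 hp
  obtain ⟨e, he, heq⟩ := (hd₀ q).1 hq
  obtain ⟨t, ht, hte⟩ := exists_iterate_eq_of_sameCycle (hd.symm.trans he)
  refine ⟨d, fun t => (hd₀ _).2 ⟨_, hd.trans ⟨t, ?_⟩, rfl⟩, hdp, t, ht, by rw [hte, heq]⟩
  rw [Equiv.Perm.iterate_eq_pow, zpow_natCast]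

lemma IsFaceVertexSet.preconnected [Finite V] (hΓ : R.IsFaceVertexSet Γ) :
    (G.induce {v | v ∈ Γ}).Preconnected := by
  rintro ⟨p, hp⟩ ⟨q, hq⟩
  obtain ⟨d, hd, rfl, t, -, rfl⟩ := hΓ.exists_tour hp hq
  obtain ⟨_, _, h⟩ := R.reachableIn_iterate d (S := {v | v ∈ Γ}) t.zero_le fun r _ _ => hd r
  exact h

end RotationSystem

end FaceTour

lemma exists_step_of_exit {P : ℕ → Prop} {s t : ℕ} (hst : s ≤ t) (hs : P s) (ht : ¬P t) :
    ∃ r, s ≤ r ∧ r < t ∧ P r ∧ ¬P (r + 1) := by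
  induction t, hst using Nat.le_induction with
  | base => exact absurd hs ht
  | succ t hst ih =>
    by_cases h : P t
    · exact ⟨t, hst, t.lt_succ_self, h, ht⟩
    · obtain ⟨r, hsr, hrt, hr⟩ := ih h
      exact ⟨r, hsr, hrt.trans t.lt_succ_self, hr⟩

section Fin

variable {n : ℕ}

lemma val_nsmul_one (t : ℕ) : (t • (1 : Fin (n + 2))).val = t % (n + 2) := by
  induction t with
  | zero => simp
  | succ t ih => rw [succ_nsmul, Fin.val_add, ih, Fin.val_one, Nat.mod_add_mod]

lemma val_nsmul_one_self (i : Fin (n + 2)) : i.val • (1 : Fin (n + 2)) = i :=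
  Fin.ext (by rw [val_nsmul_one, Nat.mod_eq_of_lt i.2])

lemma add_val_sub_nsmul_one (i j : Fin (n + 2)) : i + (j - i).val • 1 = j := by
  rw [val_nsmul_one_self, add_sub_cancel]

lemma ne_add_two (hn : 1 ≤ n) (i : Fin (n + 2)) : i ≠ i + 1 + 1 := by
  rw [add_assoc, ne_eq, left_eq_add, Fin.ext_iff, Fin.val_add, Fin.val_one,
    Nat.mod_eq_of_lt (by omega)]
  simp

end Fin

section GridAdjacency

variable {n m : ℕ} {i j : Fin (n + 2)}

lemma grid_adj_add_one (i : Fin (n + 2)) (j : Fin (m + 2)) :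
    (grid (n + 2) (m + 2)).Adj (i, j) (i + 1, j) := by
  simp [grid, SimpleGraph.boxProd_adj, SimpleGraph.cycleGraph_adj]

lemma grid_adj_castSucc_succ (i : Fin (n + 2)) (j : Fin (m + 1)) :
    (grid (n + 2) (m + 2)).Adj (i, j.castSucc) (i, j.succ) := by
  simp [grid, SimpleGraph.boxProd_adj, SimpleGraph.pathGraph_adj]

lemma eq_add_one_of_gridStar_adj {j₀ : Fin (m + 2)}
    (h : (gridStar (n + 2) (m + 2)).Adj (i, j₀) (j, j₀)) : j = i + 1 ∨ i = j + 1 := by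
  simp only [gridStar, grid, SimpleGraph.boxProd_adj, SimpleGraph.cycleGraph_adj,
    SimpleGraph.pathGraph_adj, sub_eq_iff_eq_add, add_comm (1 : Fin (n + 2))] at h
  have : i = j + 1 ∨ j = i + 1 := by simpa using h
  exact this.symm

/-- A vertex of the first row can be bypassed through the second row. -/
lemma reachableIn_ne {H : SimpleGraph (Fin (n + 2) × Fin (m + 2))}
    (hgrid : grid (n + 2) (m + 2) ≤ H) {i₀ : Fin (n + 2)} (hi : i ≠ i₀) (hj : j ≠ i₀) :
    ReachableIn H {x | x ≠ (i₀, 0)} (i, 0) (j, 0) := by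
  have hdown (i : Fin (n + 2)) (hi : i ≠ i₀) :
      ReachableIn H {x | x ≠ (i₀, 0)} (i, 0) (i, 1) :=
    .of_adj (hgrid (grid_adj_castSucc_succ i 0)) (by simp [hi]) (by simp)
  have hrow (t : ℕ) : ReachableIn H {x | x ≠ (i₀, 0)} (i, 1) (i + t • 1, 1) := by
    induction t with
    | zero => simpa using ReachableIn.refl (by simp)
    | succ t ih =>
      rw [succ_nsmul, ← add_assoc]
      exact ih.trans (.of_adj (hgrid (grid_adj_add_one _ 1)) (by simp) (by simp))
  have hacross := hrow (j - i).val
  rw [add_val_sub_nsmul_one] at hacross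
  exact ((hdown i hi).trans hacross).trans (hdown j hj).symm

end GridAdjacency

namespace IsAggregationPartition

variable {V : Type*} {G : SimpleGraph V} {Γ : Finset V} {M n m : ℕ}
  {H : SimpleGraph (Fin (n + 2) × Fin (m + 2))} {a : Fin (n + 2) × Fin (m + 2) → Finset V}
  {aStar : Finset V} {C : V → Fin (n + 2)}

lemma eq_of_mem (hP : IsAggregationPartition G Γ M H a aStar) {x y v} (hx : v ∈ a x)
    (hy : v ∈ a y) : x = y := by
  by_contra h
  exact Finset.disjoint_left.1 (hP.disjoint x y h) hx hy

lemma exists_column (hP : IsAggregationPartition G Γ M H a aStar) :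
    ∃ C : V → Fin (n + 2), ∀ v ∈ Γ, v ∈ a (C v, 0) := by
  have hcol (v : V) : ∃ i : Fin (n + 2), v ∈ Γ → v ∈ a (i, 0) := by
    by_cases hv : v ∈ Γ
    · obtain ⟨i, j, hj, h⟩ := hP.boundary_subset v hv
      rw [show j = 0 from Fin.ext hj] at h
      exact ⟨i, fun _ => h⟩
    · exact ⟨0, fun h => absurd h hv⟩
  choose C hC using hcol
  exact ⟨C, hC⟩

lemma exists_mem_column (hP : IsAggregationPartition G Γ M H a aStar)
    (hC : ∀ v ∈ Γ, v ∈ a (C v, 0)) (i : Fin (n + 2)) : ∃ v ∈ Γ, C v = i := by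
  obtain ⟨v, hv, hvi⟩ := hP.boundary_meets i 0 rfl
  exact ⟨v, hv, congrArg Prod.fst (hP.eq_of_mem (hC v hv) hvi)⟩

lemma reachableIn_biUnion (hP : IsAggregationPartition G Γ M H a aStar)
    {X : Set (Fin (n + 2) × Fin (m + 2))} {x y : Fin (n + 2) × Fin (m + 2)}
    (h : ReachableIn H X x y) {v w : V} (hv : v ∈ a x) (hw : w ∈ a y) :
    ReachableIn G {v | ∃ x ∈ X, v ∈ a x} v w := by
  have hblock {z v w} (hz : z ∈ X) (hv : v ∈ a z) (hw : w ∈ a z) :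
      ReachableIn G {v | ∃ x ∈ X, v ∈ a x} v w :=
    (ReachableIn.of_preconnected (hP.connected z).preconnected hv hw).mono fun v hv => ⟨z, hz, hv⟩
  have hy := h.symm.1
  suffices ∀ v ∈ a x, ReachableIn G {v | ∃ x ∈ X, v ∈ a x} v w from this v hv
  refine h.head_induction_on (fun v hv => hblock hy hv hw) fun x z hx hz hxz _ ih v hv => ?_
  obtain ⟨v', hv', w', hw', hvw⟩ := (hP.adj_iff _ _ hxz.ne).1 hxz
  have hcross : ReachableIn G {v | ∃ x ∈ X, v ∈ a x} v' w' :=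
    .of_adj hvw ⟨x, hx, hv'⟩ ⟨z, hz, hw'⟩
  exact (hblock hx hv hv').trans (hcross.trans (ih w' hw'))

lemma column_adj (hP : IsAggregationPartition G Γ M H a aStar)
    (hstar : H ≤ gridStar (n + 2) (m + 2)) (hC : ∀ v ∈ Γ, v ∈ a (C v, 0)) {v w : V} (hv : v ∈ Γ)
    (hw : w ∈ Γ) (h : G.Adj v w) : C w = C v ∨ C w = C v + 1 ∨ C v = C w + 1 := by
  by_cases hvw : C v = C w
  · exact Or.inl hvw.symm
  · exact Or.inr (eq_add_one_of_gridStar_adj (j₀ := 0)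
      (hstar ((hP.adj_iff _ _ (by simpa using hvw)).2 ⟨v, hC v hv, w, hC w hw, h⟩)))

section Tour

variable [Finite V] {R : RotationSystem G}

lemma column_noncrossing (hP : IsAggregationPartition G Γ M H a aStar)
    (hgrid : grid (n + 2) (m + 2) ≤ H) (hC : ∀ v ∈ Γ, v ∈ a (C v, 0)) (hR : R.IsPlanar)
    (hG : G.Preconnected) {d : G.Dart} (hd : ∀ t, (R.facePerm^[t] d).fst ∈ Γ) {q r s t : ℕ}
    (hqr : q ≤ r) (hrs : r ≤ s) (hst : s ≤ t) (htq : t ≤ q + Function.minimalPeriod R.facePerm d)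
    (hs : C (R.facePerm^[s] d).fst = C (R.facePerm^[q] d).fst) :
    C (R.facePerm^[r] d).fst = C (R.facePerm^[q] d).fst ∨
      C (R.facePerm^[t] d).fst = C (R.facePerm^[q] d).fst := by
  by_contra! ⟨hr, ht⟩
  have hrs' : r < s := hrs.lt_of_ne (by rintro rfl; exact hr hs)
  have htq' : t < q + Function.minimalPeriod R.facePerm d := htq.lt_of_ne (by
    rintro rfl
    rw [Function.iterate_add_apply, Function.iterate_minimalPeriod] at ht
    exact ht rfl)
  have hshift {i : ℕ} (hi : q ≤ i) :
      R.facePerm^[i] d = R.facePerm^[i - q] (R.facePerm^[q] d) := by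
    rw [← Function.iterate_add_apply, Nat.sub_add_cancel hi]
  have hperiod : Function.minimalPeriod R.facePerm (R.facePerm^[q] d) =
      Function.minimalPeriod R.facePerm d := by
    classical
    have := Fintype.ofFinite V
    exact Function.minimalPeriod_apply_iterate (R.facePerm.injective.mem_periodicPts d) q
  have hA : ReachableIn G {v | v ∈ a (C (R.facePerm^[q] d).fst, 0)} (R.facePerm^[q] d).fst
      (R.facePerm^[s] d).fst :=
    .of_preconnected (hP.connected _).preconnected (hC _ (hd q)) (hs ▸ hC _ (hd s))
  have hB := hP.reachableIn_biUnion (reachableIn_ne hgrid hr ht) (hC _ (hd r)) (hC _ (hd t))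
  rw [hshift (hqr.trans hrs)] at hA
  rw [hshift hqr, hshift (hqr.trans (hrs.trans hst))] at hB
  refine hR.noncrossing hG (by omega) (by omega) (by omega) ?_ hA hB
  exact Set.disjoint_left.2 fun v hv ⟨x, hx, hvx⟩ => hx (hP.eq_of_mem hvx hv)

lemma reachableIn_column (hP : IsAggregationPartition G Γ M H a aStar)
    (hgrid : grid (n + 2) (m + 2) ≤ H) (hC : ∀ v ∈ Γ, v ∈ a (C v, 0)) (hR : R.IsPlanar)
    (hG : G.Preconnected) (hΓ : R.IsFaceVertexSet Γ) {p q : V} (hp : p ∈ Γ) (hq : q ∈ Γ)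
    (hpq : C q = C p) : ReachableIn G {v | v ∈ Γ ∧ C v = C p} p q := by
  obtain ⟨d, hd, rfl, t, ht, rfl⟩ := hΓ.exists_tour hp hq
  by_cases hbefore : ∀ r, 0 ≤ r → r ≤ t → C (R.facePerm^[r] d).fst = C d.fst
  · exact R.reachableIn_iterate d t.zero_le fun r hr hrt => ⟨hd r, hbefore r hr hrt⟩
  push Not at hbefore
  obtain ⟨r, hr, hrt, hne⟩ := hbefore
  have hafter := R.reachableIn_iterate d ht.le (S := {v | v ∈ Γ ∧ C v = C d.fst})
    fun s hts hs => ⟨hd s, (hP.column_noncrossing hgrid hC hR hG hd hr hrt hts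
      (hs.trans_eq (zero_add _).symm) hpq).resolve_left hne⟩
  rw [Function.iterate_minimalPeriod] at hafter
  exact hafter.symm

/-- Otherwise a tour from column `i + 1` to column `i` and back would leave column `i + 1` into
column `i + 2` and return from there, although column `i + 2` is an arc of the tour. -/
lemma exists_adj_column_succ (hP : IsAggregationPartition G Γ M H a aStar)
    (hgrid : grid (n + 2) (m + 2) ≤ H) (hstar : H ≤ gridStar (n + 2) (m + 2)) (hn : 1 ≤ n)
    (hC : ∀ v ∈ Γ, v ∈ a (C v, 0)) (hR : R.IsPlanar) (hG : G.Preconnected)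
    (hΓ : R.IsFaceVertexSet Γ) (i : Fin (n + 2)) :
    ∃ p ∈ Γ, ∃ q ∈ Γ, G.Adj p q ∧ C p = i ∧ C q = i + 1 := by
  by_contra! hno
  have hexit {p q : V} (hp : p ∈ Γ) (hq : q ∈ Γ) (hpq : G.Adj p q) (hCp : C p = i + 1)
      (hCq : C q ≠ i + 1) : C q = i + 1 + 1 := by
    rcases hP.column_adj hstar hC hp hq hpq with h | h | h
    · exact absurd (h.trans hCp) hCq
    · rw [h, hCp]
    · exact absurd hCp (hno q hq p hp hpq.symm (add_right_cancel (h.symm.trans hCp)))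
  obtain ⟨p, hp, hpi⟩ := hP.exists_mem_column hC (i + 1)
  obtain ⟨q, hq, hqi⟩ := hP.exists_mem_column hC i
  obtain ⟨d, hd, rfl, t, ht, rfl⟩ := hΓ.exists_tour hp hq
  have hback : C (R.facePerm^[Function.minimalPeriod R.facePerm d] d).fst = i + 1 := by
    rw [Function.iterate_minimalPeriod, hpi]
  have hti : C (R.facePerm^[t] d).fst ≠ i + 1 := by simp [hqi]
  obtain ⟨r, -, hrt, hr, hr'⟩ :=
    exists_step_of_exit (P := fun r => C (R.facePerm^[r] d).fst = i + 1) t.zero_le hpi hti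
  obtain ⟨s, hts, hsN, hs, hs'⟩ :=
    exists_step_of_exit (P := fun r => C (R.facePerm^[r] d).fst ≠ i + 1) ht.le hti
      (not_not.2 hback)
  have hleave := hexit (hd r) (hd (r + 1)) (R.adj_iterate_facePerm d r) hr hr'
  have hreturn := hexit (hd (s + 1)) (hd s) (R.adj_iterate_facePerm d s).symm (not_not.1 hs') hs
  rcases hP.column_noncrossing hgrid hC hR hG hd (Nat.succ_le_of_lt hrt) hts hsN.le
    (Nat.le_add_left _ _) (hreturn.trans hleave.symm) with h | h
  · exact ne_add_two hn i (hqi.symm.trans (h.trans hleave))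
  · exact absurd (hback.symm.trans (h.trans hleave)) (by simp)

lemma reachableIn_columns (hP : IsAggregationPartition G Γ M H a aStar)
    (hgrid : grid (n + 2) (m + 2) ≤ H) (hstar : H ≤ gridStar (n + 2) (m + 2)) (hn : 1 ≤ n)
    (hC : ∀ v ∈ Γ, v ∈ a (C v, 0)) (hR : R.IsPlanar) (hG : G.Preconnected)
    (hΓ : R.IsFaceVertexSet Γ) {p q : V} (hp : p ∈ Γ) (hq : q ∈ Γ) {t : ℕ}
    (hpq : C q = C p + t • 1) :
    ReachableIn G {v | v ∈ Γ ∧ ∃ e ≤ t, C v = C p + e • 1} p q := by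
  induction t generalizing q with
  | zero =>
    refine (hP.reachableIn_column hgrid hC hR hG hΓ hp hq (by simpa using hpq)).mono ?_
    exact fun v hv => ⟨hv.1, 0, le_rfl, by simp [hv.2]⟩
  | succ t ih =>
    obtain ⟨p', hp', q', hq', hadj, hCp', hCq'⟩ :=
      hP.exists_adj_column_succ hgrid hstar hn hC hR hG hΓ (C p + t • 1)
    have hCq : C q' = C p + (t + 1) • 1 := by rw [hCq', succ_nsmul, add_assoc]
    have hpp' : ReachableIn G {v | v ∈ Γ ∧ ∃ e ≤ t + 1, C v = C p + e • 1} p p' :=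
      (ih hp' hCp').mono fun _ hv => hv.imp_right fun ⟨e, he, hve⟩ => ⟨e, he.trans t.le_succ, hve⟩
    have hqq' : ReachableIn G {v | v ∈ Γ ∧ ∃ e ≤ t + 1, C v = C p + e • 1} q' q :=
      (hP.reachableIn_column hgrid hC hR hG hΓ hq' hq (hpq.trans hCq.symm)).mono
        fun _ hv => ⟨hv.1, t + 1, le_rfl, hv.2.trans hCq⟩
    have hp'q' : ReachableIn G {v | v ∈ Γ ∧ ∃ e ≤ t + 1, C v = C p + e • 1} p' q' :=
      .of_adj hadj ⟨hp', t, t.le_succ, hCp'⟩ ⟨hq', t + 1, le_rfl, hCq⟩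
    exact (hpp'.trans hp'q').trans hqq'

theorem dist_lt_of_column_eq_add (hP : IsAggregationPartition G Γ M H a aStar)
    (hgrid : grid (n + 2) (m + 2) ≤ H) (hstar : H ≤ gridStar (n + 2) (m + 2)) (hn : 1 ≤ n)
    (hC : ∀ v ∈ Γ, v ∈ a (C v, 0)) (hR : R.IsPlanar) (hG : G.Preconnected)
    (hΓ : R.IsFaceVertexSet Γ) (p q : {v // v ∈ Γ}) (t : ℕ) (hpq : C q = C p + t • 1) :
    (G.induce {v | v ∈ Γ}).dist p q < M * (t + 1) := by
  classical
  let S := Γ.filter fun v => ∃ e ≤ t, C v = C p + e • 1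
  have hreach : ReachableIn G {v | v ∈ S} p q := by
    simpa only [S, Finset.mem_filter] using
      hP.reachableIn_columns hgrid hstar hn hC hR hG hΓ p.2 q.2 hpq
  have hsub : S ⊆ (Finset.range (t + 1)).biUnion fun e => a (C p + e • 1, 0) := by
    intro v hv
    obtain ⟨hvΓ, e, he, hve⟩ := Finset.mem_filter.1 hv
    exact Finset.mem_biUnion.2 ⟨e, Finset.mem_range.2 (by omega), hve ▸ hC v hvΓ⟩
  calc (G.induce {v | v ∈ Γ}).dist p q
      < S.card := hreach.dist_lt_card (Finset.filter_subset _ _) p.2 q.2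
    _ ≤ _ := Finset.card_le_card hsub
    _ ≤ (Finset.range (t + 1)).card * M :=
      Finset.card_biUnion_le_card_mul _ _ _ fun e _ => hP.card_le _
    _ = M * (t + 1) := by rw [Finset.card_range, mul_comm]

end Tour

end IsAggregationPartition

lemma hardy_inequality (x : ℕ → ℝ) (N : ℕ) :
    ∑ d ∈ Finset.range N, ((∑ s ∈ Finset.range (d + 1), x s) / (d + 1)) ^ 2 ≤
      4 * ∑ d ∈ Finset.range N, x d ^ 2 := by
  -- The extra nonnegative term on the left makes the inequality inductive.
  suffices h : ∑ d ∈ Finset.range N, ((∑ s ∈ Finset.range (d + 1), x s) / (d + 1)) ^ 2 +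
      2 * N * ((∑ s ∈ Finset.range N, x s) / N) ^ 2 ≤ 4 * ∑ d ∈ Finset.range N, x d ^ 2 from
    (le_add_of_nonneg_right (by positivity)).trans h
  induction N with
  | zero => simp
  | succ N ih =>
    rw [Finset.sum_range_succ, Finset.sum_range_succ fun d => x d ^ 2]
    push_cast
    set y := (∑ s ∈ Finset.range (N + 1), x s) / ((N : ℝ) + 1) with hy
    set z := (∑ s ∈ Finset.range N, x s) / (N : ℝ) with hz
    have hz' : (N : ℝ) * z = ∑ s ∈ Finset.range N, x s := by
      rcases N.eq_zero_or_pos with rfl | hN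
      · simp
      · rw [hz]
        field_simp
    have hx : x N = (N + 1) * y - N * z := by
      rw [hz', hy, mul_div_cancel₀ _ (by positivity), Finset.sum_range_succ, add_sub_cancel_left]
    have hstep : 4 * x N ^ 2 - y ^ 2 - 2 * (N + 1) * y ^ 2 + 2 * N * z ^ 2 =
        (2 * x N - y) ^ 2 + 2 * N * (z - y) ^ 2 := by
      rw [hx]
      ring
    have hnonneg : 0 ≤ (2 * x N - y) ^ 2 + 2 * N * (z - y) ^ 2 := by positivity
    linarith

lemma sum_sq_sub_zero_div_le (u : ℕ → ℝ) (L N : ℕ) :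
    ∑ d ∈ Finset.range N, ((u (d % (L + 1)) - u 0) / (d + 1)) ^ 2 ≤
      4 * ∑ j ∈ Finset.range L, (u (j + 1) - u j) ^ 2 := by
  let b (s : ℕ) : ℝ := if s < L then |u (s + 1) - u s| else 0
  have hb (s : ℕ) : 0 ≤ b s := by
    simp only [b]
    split_ifs <;> positivity
  have hub (d : ℕ) : |u (d % (L + 1)) - u 0| ≤ ∑ s ∈ Finset.range (d + 1), b s := by
    have hlt : d % (L + 1) < L + 1 := Nat.mod_lt d L.succ_pos
    calc |u (d % (L + 1)) - u 0|
        ≤ ∑ s ∈ Finset.range (d % (L + 1)), |u (s + 1) - u s| := by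
          rw [← Finset.sum_range_sub]
          exact Finset.abs_sum_le_sum_abs _ _
      _ = ∑ s ∈ Finset.range (d % (L + 1)), b s :=
          Finset.sum_congr rfl fun s hs => (if_pos (by have := Finset.mem_range.1 hs; omega)).symm
      _ ≤ _ := Finset.sum_le_sum_of_subset_of_nonneg
          (Finset.range_mono ((Nat.mod_le d _).trans d.le_succ)) fun s _ _ => hb s
  calc ∑ d ∈ Finset.range N, ((u (d % (L + 1)) - u 0) / (d + 1)) ^ 2
      ≤ ∑ d ∈ Finset.range N, ((∑ s ∈ Finset.range (d + 1), b s) / (d + 1)) ^ 2 := by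
        gcongr ∑ d ∈ _, ?_ with d
        rw [div_pow, div_pow, ← sq_abs]
        gcongr
        exact hub d
    _ ≤ 4 * ∑ d ∈ Finset.range N, b d ^ 2 := hardy_inequality b N
    _ = 4 * ∑ d ∈ (Finset.range N).filter (· < L), (u (d + 1) - u d) ^ 2 := by
        simp only [b, ite_pow, sq_abs, ne_eq, OfNat.ofNat_ne_zero, not_false_eq_true, zero_pow,
          Finset.sum_filter]
    _ ≤ _ := by
        gcongr ?_ * ?_
        exact Finset.sum_le_sum_of_subset_of_nonneg
          (fun d hd => Finset.mem_range.2 (Finset.mem_filter.1 hd).2) fun _ _ _ => sq_nonneg _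

lemma sum_range_mul_mod {R : Type*} [NonAssocSemiring R] (F : ℕ → R) (c l : ℕ) :
    ∑ d ∈ Finset.range (c * l), F (d % l) = c * ∑ j ∈ Finset.range l, F j := by
  induction c with
  | zero => simp
  | succ c ih =>
    have hblock : ∑ x ∈ Finset.range l, F ((c * l + x) % l) = ∑ x ∈ Finset.range l, F x :=
      Finset.sum_congr rfl fun x hx => by
        rw [Nat.mul_add_mod_self_right, Nat.mod_eq_of_lt (Finset.mem_range.1 hx)]
    rw [Nat.succ_mul, Finset.sum_range_add, ih, hblock, Nat.cast_succ, add_mul, one_mul]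

section ShiftForm

variable {A : Type*} [AddGroup A] [Fintype A]

/-- The sum of the squared increments of `ψ` at distance `t` in the direction `e`. -/
noncomputable def shiftSq (ψ : A → ℝ) (e : A) (t : ℕ) : ℝ :=
  ∑ i, (ψ (i + t • e) - ψ i) ^ 2

/-- The discrete `H^{1/2}` form of `ψ` along the direction `e`, truncated to the increments at
distance at most `N`. -/
noncomputable def shiftForm (ψ : A → ℝ) (e : A) (N : ℕ) : ℝ :=
  ∑ t ∈ Finset.range N, shiftSq ψ e (t + 1) / ((t : ℝ) + 1) ^ 2

lemma shiftSq_nonneg (ψ : A → ℝ) (e : A) (t : ℕ) : 0 ≤ shiftSq ψ e t :=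
  Finset.sum_nonneg fun _ _ => sq_nonneg _

lemma shiftForm_mono (ψ : A → ℝ) (e : A) : Monotone (shiftForm ψ e) := fun _ _ h =>
  Finset.sum_le_sum_of_subset_of_nonneg (Finset.range_mono h) fun t _ _ =>
    div_nonneg (shiftSq_nonneg ψ e (t + 1)) (by positivity)

lemma sum_comp_add_right {B : Type*} [AddCommMonoid B] (g : A → B) (e : A) :
    ∑ i, g (i + e) = ∑ i, g i :=
  Equiv.sum_comp (Equiv.addRight e) g

lemma shiftSq_le_sq_mul (ψ : A → ℝ) (e : A) (t : ℕ) :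
    shiftSq ψ e t ≤ (t : ℝ) ^ 2 * ∑ i, (ψ (i + e) - ψ i) ^ 2 := by
  have hpath (i : A) : ψ (i + t • e) - ψ i =
      ∑ s ∈ Finset.range t, (ψ (i + s • e + e) - ψ (i + s • e)) := by
    simpa only [zero_smul, add_zero, succ_nsmul, ← add_assoc] using
      (Finset.sum_range_sub (fun s => ψ (i + s • e)) t).symm
  calc shiftSq ψ e t
      ≤ ∑ i, t * ∑ s ∈ Finset.range t, (ψ (i + s • e + e) - ψ (i + s • e)) ^ 2 := by
        refine Finset.sum_le_sum fun i _ => ?_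
        rw [hpath]
        simpa only [Finset.card_range] using sq_sum_le_card_mul_sum_sq (s := Finset.range t)
    _ = t * ∑ s ∈ Finset.range t, ∑ i, (ψ (i + s • e + e) - ψ (i + s • e)) ^ 2 := by
        rw [← Finset.mul_sum, Finset.sum_comm]
    _ = (t : ℝ) ^ 2 * ∑ i, (ψ (i + e) - ψ i) ^ 2 := by
        simp only [sum_comp_add_right fun i => (ψ (i + e) - ψ i) ^ 2, Finset.sum_const,
          Finset.card_range, nsmul_eq_mul]
        ring

lemma sq_sub_le_three_mul (x x' y y' : ℝ) :
    (x - y) ^ 2 ≤ 3 * (x' - x) ^ 2 + 3 * (x' - y') ^ 2 + 3 * (y' - y) ^ 2 := by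
  nlinarith only [sq_nonneg ((x - x') - (x' - y')), sq_nonneg ((x' - y') - (y' - y)),
    sq_nonneg ((x - x') - (y' - y))]

lemma shiftSq_le_add (ψ χ : A → ℝ) (e : A) (t : ℕ) :
    shiftSq ψ e t ≤ 6 * ∑ i, (χ i - ψ i) ^ 2 + 3 * shiftSq χ e t := by
  calc shiftSq ψ e t
      ≤ ∑ i, (3 * (χ (i + t • e) - ψ (i + t • e)) ^ 2 + 3 * (χ (i + t • e) - χ i) ^ 2 +
          3 * (χ i - ψ i) ^ 2) := Finset.sum_le_sum fun i _ => sq_sub_le_three_mul _ _ _ _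
    _ = _ := by
        simp only [Finset.sum_add_distrib, ← Finset.mul_sum, shiftSq,
          sum_comp_add_right fun i => (χ i - ψ i) ^ 2]
        ring

theorem cylinder_trace (U : A → ℕ → ℝ) (e : A) (c L : ℕ) :
    shiftForm (U · 0) e (c * (L + 1)) ≤
      3 * c * ∑ j ∈ Finset.range (L + 1), ∑ i, (U (i + e) j - U i j) ^ 2 +
        24 * ∑ j ∈ Finset.range L, ∑ i, (U i (j + 1) - U i j) ^ 2 := by
  -- The increment at distance `d + 1` is taken along row `d % (L + 1)`.
  let row (j : ℕ) : ℝ := ∑ i, (U (i + e) j - U i j) ^ 2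
  have hterm (d : ℕ) : shiftSq (U · 0) e (d + 1) / ((d : ℝ) + 1) ^ 2 ≤
      6 * ∑ i, ((U i (d % (L + 1)) - U i 0) / (d + 1)) ^ 2 + 3 * row (d % (L + 1)) := by
    have hrow := shiftSq_le_sq_mul (U · (d % (L + 1))) e (d + 1)
    have hsplit := shiftSq_le_add (U · 0) (U · (d % (L + 1))) e (d + 1)
    rw [div_le_iff₀ (by positivity)]
    simp only [div_pow, ← Finset.sum_div]
    rw [add_mul, mul_assoc, div_mul_cancel₀ _ (by positivity)]
    push_cast at hrow
    linarith
  calc shiftForm (U · 0) e (c * (L + 1))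
      ≤ ∑ d ∈ Finset.range (c * (L + 1)),
          (6 * ∑ i, ((U i (d % (L + 1)) - U i 0) / (d + 1)) ^ 2 + 3 * row (d % (L + 1))) :=
        Finset.sum_le_sum fun d _ => hterm d
    _ = 6 * ∑ i, ∑ d ∈ Finset.range (c * (L + 1)),
          ((U i (d % (L + 1)) - U i 0) / (d + 1)) ^ 2 +
        3 * (c * ∑ j ∈ Finset.range (L + 1), row j) := by
        rw [Finset.sum_add_distrib, ← Finset.mul_sum, ← Finset.mul_sum, Finset.sum_comm,
          sum_range_mul_mod]
    _ ≤ 6 * ∑ i, (4 * ∑ j ∈ Finset.range L, (U i (j + 1) - U i j) ^ 2) +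
        3 * (c * ∑ j ∈ Finset.range (L + 1), row j) := by
        gcongr with i
        exact sum_sq_sub_zero_div_le (U i) L _
    _ = _ := by
        rw [← Finset.mul_sum, Finset.sum_comm (s := Finset.univ)]
        ring

end ShiftForm

section WindowMean

variable {A : Type*} [AddGroup A]

/-- The mean of `ψ` over the window `i, i + e, …, i + j • e`. -/
noncomputable def windowMean (ψ : A → ℝ) (e i : A) (j : ℕ) : ℝ :=
  (∑ s ∈ Finset.range (j + 1), ψ (i + s • e)) / (j + 1)

lemma windowMean_add_sub (ψ : A → ℝ) (e i : A) (j : ℕ) :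
    windowMean ψ e (i + e) j - windowMean ψ e i j = (ψ (i + (j + 1) • e) - ψ i) / (j + 1) := by
  have htelescope := Finset.sum_range_sub (fun s => ψ (i + s • e)) (j + 1)
  rw [Finset.sum_sub_distrib, zero_smul, add_zero] at htelescope
  rw [windowMean, windowMean, ← sub_div, ← htelescope]
  simp only [succ_nsmul', add_assoc]

lemma windowMean_succ_sub (ψ : A → ℝ) (e i : A) (j : ℕ) :
    windowMean ψ e i (j + 1) - windowMean ψ e i j =
      (∑ s ∈ Finset.range (j + 1), (ψ (i + (j + 1) • e) - ψ (i + s • e))) / (j + 1) /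
        (j + 2) := by
  rw [windowMean, windowMean, Finset.sum_range_succ _ (j + 1), Finset.sum_sub_distrib,
    Finset.sum_const, Finset.card_range, nsmul_eq_mul]
  push_cast
  field_simp
  ring

lemma sq_sum_range_div_le (f : ℕ → ℝ) (j : ℕ) :
    ((∑ s ∈ Finset.range (j + 1), f s) / (j + 1)) ^ 2 ≤
      (∑ s ∈ Finset.range (j + 1), f s ^ 2) / (j + 1) := by
  simpa only [Finset.card_range, Nat.cast_succ] using
    sum_div_card_sq_le_sum_sq_div_card (s := Finset.range (j + 1)) (f := f)

variable [Fintype A]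

lemma sum_sq_windowMean_sub_le (ψ : A → ℝ) (e : A) (x : ℝ) (j : ℕ) :
    ∑ i, (windowMean ψ e i j - x) ^ 2 ≤ ∑ i, (ψ i - x) ^ 2 := by
  have hsub (i : A) : windowMean ψ e i j - x =
      (∑ s ∈ Finset.range (j + 1), (ψ (i + s • e) - x)) / (j + 1) := by
    rw [windowMean, Finset.sum_sub_distrib, Finset.sum_const, Finset.card_range, nsmul_eq_mul]
    push_cast
    field_simp
  calc ∑ i, (windowMean ψ e i j - x) ^ 2
      ≤ ∑ i, (∑ s ∈ Finset.range (j + 1), (ψ (i + s • e) - x) ^ 2) / (j + 1) :=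
        Finset.sum_le_sum fun i _ => hsub i ▸ sq_sum_range_div_le _ j
    _ = (∑ s ∈ Finset.range (j + 1), ∑ i, (ψ (i + s • e) - x) ^ 2) / (j + 1) := by
        rw [← Finset.sum_div, Finset.sum_comm]
    _ = ∑ i, (ψ i - x) ^ 2 := by
        simp only [sum_comp_add_right fun i => (ψ i - x) ^ 2, Finset.sum_const,
          Finset.card_range, nsmul_eq_mul]
        push_cast
        field_simp

lemma sum_sq_sub_eq_shiftSq (ψ : A → ℝ) (e : A) {s t : ℕ} (hst : s ≤ t) :
    ∑ i, (ψ (i + t • e) - ψ (i + s • e)) ^ 2 = shiftSq ψ e (t - s) := by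
  rw [shiftSq, ← sum_comp_add_right (fun i => (ψ (i + (t - s) • e) - ψ i) ^ 2) (s • e)]
  simp only [add_assoc, ← add_nsmul, Nat.add_sub_cancel' hst]

lemma sum_sq_windowMean_succ_sub_le (ψ : A → ℝ) (e : A) (j : ℕ) :
    ∑ i, (windowMean ψ e i (j + 1) - windowMean ψ e i j) ^ 2 ≤
      (∑ t ∈ Finset.range (j + 1), shiftSq ψ e (t + 1)) / (j + 1) / (j + 2) ^ 2 := by
  calc ∑ i, (windowMean ψ e i (j + 1) - windowMean ψ e i j) ^ 2
      ≤ ∑ i, (∑ s ∈ Finset.range (j + 1), (ψ (i + (j + 1) • e) - ψ (i + s • e)) ^ 2) / (j + 1) /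
          (j + 2) ^ 2 := by
        gcongr with i
        rw [windowMean_succ_sub, div_pow]
        gcongr
        exact sq_sum_range_div_le _ j
    _ = (∑ s ∈ Finset.range (j + 1), shiftSq ψ e (j + 1 - 1 - s + 1)) / (j + 1) /
          (j + 2) ^ 2 := by
        rw [← Finset.sum_div, ← Finset.sum_div, Finset.sum_comm]
        congr 2
        refine Finset.sum_congr rfl fun s hs => ?_
        have hs := Finset.mem_range.1 hs
        rw [sum_sq_sub_eq_shiftSq ψ e hs.le, show j + 1 - s = j + 1 - 1 - s + 1 by omega]
    _ = _ := by rw [Finset.sum_range_reflect fun t => shiftSq ψ e (t + 1)]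

end WindowMean

lemma sum_partial_sums_div_le (D : ℕ → ℝ) (hD : ∀ t, 0 ≤ D t) (N : ℕ) :
    ∑ j ∈ Finset.range N, (∑ t ∈ Finset.range (j + 1), D t) / ((j : ℝ) + 1) / (j + 2) ^ 2 ≤
      (∑ t ∈ Finset.range N, D t / ((t : ℝ) + 1) ^ 2) / 2 := by
  -- The extra nonnegative term on the left makes the inequality inductive.
  suffices h : ∑ j ∈ Finset.range N,
        (∑ t ∈ Finset.range (j + 1), D t) / ((j : ℝ) + 1) / (j + 2) ^ 2 +
      (∑ t ∈ Finset.range N, D t) / ((N : ℝ) + 1) ^ 2 / 2 ≤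
      (∑ t ∈ Finset.range N, D t / ((t : ℝ) + 1) ^ 2) / 2 by
    have hnonneg := Finset.sum_nonneg fun t (_ : t ∈ Finset.range N) => hD t
    exact (le_add_of_nonneg_right (by positivity)).trans h
  induction N with
  | zero => simp
  | succ N ih =>
    rw [Finset.sum_range_succ, Finset.sum_range_succ fun t => D t / ((t : ℝ) + 1) ^ 2]
    have hS : ∑ t ∈ Finset.range N, D t = ∑ t ∈ Finset.range (N + 1), D t - D N :=
      eq_sub_of_add_eq (Finset.sum_range_succ D N).symm
    have hS0 : 0 ≤ ∑ t ∈ Finset.range (N + 1), D t := Finset.sum_nonneg fun t _ => hD t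
    set S := ∑ t ∈ Finset.range (N + 1), D t
    have hstep : S / ((N : ℝ) + 1) ^ 2 / 2 -
        (S / ((N : ℝ) + 1) / (N + 2) ^ 2 + S / ((N : ℝ) + 2) ^ 2 / 2) =
        S / (2 * ((N : ℝ) + 1) ^ 2 * (N + 2) ^ 2) := by
      field_simp
      ring
    have hstep0 : 0 ≤ S / (2 * ((N : ℝ) + 1) ^ 2 * (N + 2) ^ 2) := by positivity
    rw [hS, sub_div] at ih
    rw [Nat.cast_succ, add_assoc (N : ℝ) 1 1, one_add_one_eq_two]
    linarith

section CylinderExtension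

variable {A : Type*} [AddGroup A]

/-- An extension of `ψ` from the first row of a cylinder with rows `0, …, L`: the means of `ψ` over
windows of growing width, interpolated so as to equal `x` on the last row. -/
noncomputable def cylinderExtension (ψ : A → ℝ) (e : A) (x : ℝ) (L : ℕ) (i : A) (j : ℕ) : ℝ :=
  x + (1 - j / L) * (windowMean ψ e i j - x)

@[simp]
lemma cylinderExtension_zero (ψ : A → ℝ) (e : A) (x : ℝ) (L : ℕ) (i : A) :
    cylinderExtension ψ e x L i 0 = ψ i := by
  simp [cylinderExtension, windowMean]

lemma cylinderExtension_last (ψ : A → ℝ) (e : A) (x : ℝ) {L : ℕ} (hL : L ≠ 0) (i : A) :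
    cylinderExtension ψ e x L i L = x := by
  simp [cylinderExtension, hL]

lemma sq_one_sub_div_le_one {j L : ℕ} (h : j ≤ L) : (1 - (j : ℝ) / L) ^ 2 ≤ 1 := by
  have hle : (j : ℝ) / L ≤ 1 := div_le_one_of_le₀ (by exact_mod_cast h) (by positivity)
  have hnonneg : (0 : ℝ) ≤ j / L := by positivity
  exact pow_le_one₀ (sub_nonneg.2 hle) (sub_le_self 1 hnonneg)

lemma sq_cylinderExtension_succ_sub_le (ψ : A → ℝ) (e : A) (x : ℝ) {L j : ℕ} (hj : j < L)
    (i : A) :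
    (cylinderExtension ψ e x L i (j + 1) - cylinderExtension ψ e x L i j) ^ 2 ≤
      2 * (windowMean ψ e i (j + 1) - windowMean ψ e i j) ^ 2 +
        2 / L ^ 2 * (windowMean ψ e i j - x) ^ 2 := by
  have hL : (L : ℝ) ≠ 0 := by exact_mod_cast (Nat.zero_lt_of_lt hj).ne'
  have hsub : cylinderExtension ψ e x L i (j + 1) - cylinderExtension ψ e x L i j =
      (1 - ((j + 1 : ℕ) : ℝ) / L) * (windowMean ψ e i (j + 1) - windowMean ψ e i j) +
        -(windowMean ψ e i j - x) / L := by
    rw [cylinderExtension, cylinderExtension]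
    push_cast
    field_simp
    ring
  calc (cylinderExtension ψ e x L i (j + 1) - cylinderExtension ψ e x L i j) ^ 2
      ≤ 2 * ((1 - ((j + 1 : ℕ) : ℝ) / L) ^ 2 *
            (windowMean ψ e i (j + 1) - windowMean ψ e i j) ^ 2 +
          (windowMean ψ e i j - x) ^ 2 / L ^ 2) := by
        rw [hsub, ← mul_pow, ← neg_sq (windowMean ψ e i j - x), ← div_pow]
        exact add_sq_le
    _ ≤ 2 * (1 * (windowMean ψ e i (j + 1) - windowMean ψ e i j) ^ 2 +
          (windowMean ψ e i j - x) ^ 2 / L ^ 2) := by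
        gcongr
        exact sq_one_sub_div_le_one hj
    _ = _ := by ring

variable [Fintype A]

theorem cylinderExtension_horizontal (ψ : A → ℝ) (e : A) (x : ℝ) (L : ℕ) :
    ∑ j ∈ Finset.range (L + 1), ∑ i,
        (cylinderExtension ψ e x L (i + e) j - cylinderExtension ψ e x L i j) ^ 2 ≤
      shiftForm ψ e (L + 1) := by
  refine Finset.sum_le_sum fun j hj => ?_
  rw [shiftSq, Finset.sum_div]
  refine Finset.sum_le_sum fun i _ => ?_
  have hsub : cylinderExtension ψ e x L (i + e) j - cylinderExtension ψ e x L i j =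
      (1 - j / L) * ((ψ (i + (j + 1) • e) - ψ i) / (j + 1)) := by
    rw [← windowMean_add_sub, cylinderExtension, cylinderExtension]
    ring
  rw [hsub, mul_pow, div_pow]
  exact mul_le_of_le_one_left (by positivity)
    (sq_one_sub_div_le_one (Nat.lt_succ_iff.1 (Finset.mem_range.1 hj)))

theorem cylinderExtension_vertical (ψ : A → ℝ) (e : A) (x : ℝ) (L : ℕ) :
    ∑ j ∈ Finset.range L, ∑ i,
        (cylinderExtension ψ e x L i (j + 1) - cylinderExtension ψ e x L i j) ^ 2 ≤
      shiftForm ψ e L + 2 / L * ∑ i, (ψ i - x) ^ 2 := by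
  calc ∑ j ∈ Finset.range L, ∑ i,
        (cylinderExtension ψ e x L i (j + 1) - cylinderExtension ψ e x L i j) ^ 2
      ≤ ∑ j ∈ Finset.range L, ∑ i, (2 * (windowMean ψ e i (j + 1) - windowMean ψ e i j) ^ 2 +
          2 / L ^ 2 * (windowMean ψ e i j - x) ^ 2) :=
        Finset.sum_le_sum fun j hj => Finset.sum_le_sum fun i _ =>
          sq_cylinderExtension_succ_sub_le ψ e x (Finset.mem_range.1 hj) i
    _ ≤ ∑ j ∈ Finset.range L,
          (2 * ((∑ t ∈ Finset.range (j + 1), shiftSq ψ e (t + 1)) / (j + 1) / (j + 2) ^ 2) +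
          2 / L ^ 2 * ∑ i, (ψ i - x) ^ 2) := by
        refine Finset.sum_le_sum fun j _ => ?_
        rw [Finset.sum_add_distrib, ← Finset.mul_sum, ← Finset.mul_sum]
        gcongr 2 * ?_ + 2 / _ * ?_
        · exact sum_sq_windowMean_succ_sub_le ψ e j
        · exact sum_sq_windowMean_sub_le ψ e x _
    _ = 2 * ∑ j ∈ Finset.range L,
          (∑ t ∈ Finset.range (j + 1), shiftSq ψ e (t + 1)) / (j + 1) / (j + 2) ^ 2 +
          2 / L * ∑ i, (ψ i - x) ^ 2 := by
        rw [Finset.sum_add_distrib, ← Finset.mul_sum, Finset.sum_const, Finset.card_range,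
          nsmul_eq_mul]
        rcases eq_or_ne (L : ℝ) 0 with h | h
        · simp [h]
        · field_simp
    _ ≤ _ := by
        have h := sum_partial_sums_div_le (fun t => shiftSq ψ e (t + 1))
          (fun t => shiftSq_nonneg ψ e (t + 1)) L
        rw [shiftForm]
        linarith

end CylinderExtension

section Forms

variable {V : Type*} (G : SimpleGraph V)

/-- The sum of the squared increments of `u` over the ordered pairs of adjacent vertices `v ∈ S`,
`w ∈ T`. -/
def blockForm [DecidableRel G.Adj] (u : V → ℝ) (S T : Finset V) : ℝ :=
  ∑ v ∈ S, ∑ w ∈ T, if G.Adj v w then (u v - u w) ^ 2 else 0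

/-- Twice the Dirichlet form of a graph: every edge counts in both directions. -/
def dirichlet [Fintype V] [DecidableRel G.Adj] (u : V → ℝ) : ℝ :=
  blockForm G u Finset.univ Finset.univ

/-- Twice the quadratic form of the boundary Laplacian. -/
noncomputable def boundaryForm (Γ : Finset V) (φ : {v // v ∈ Γ} → ℝ) : ℝ :=
  ∑ p, ∑ q, ((((G.induce {v | v ∈ Γ}).dist p q : ℕ) : ℝ) ^ 2)⁻¹ * (φ p - φ q) ^ 2

lemma energy_eq_sqrt_dirichlet [Fintype V] [DecidableEq V] [DecidableRel G.Adj] (u : V → ℝ) :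
    energy G u = √(dirichlet G u / 2) := by
  rw [energy, dirichlet, blockForm, ← SimpleGraph.lapMatrix_toLinearMap₂',
    Matrix.toLinearMap₂'_apply', dotProduct_comm]

lemma weightedLaplacian_mulVec_apply {ι : Type*} [Fintype ι] [DecidableEq ι] (w : ι → ι → ℝ)
    (φ : ι → ℝ) (p : ι) : (weightedLaplacian w *ᵥ φ) p = ∑ q, w p q * (φ p - φ q) := by
  have hoff : ∑ q ∈ Finset.univ.erase p, weightedLaplacian w p q * φ q =
      ∑ q ∈ Finset.univ.erase p, -(w p q * φ q) :=
    Finset.sum_congr rfl fun q hq => by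
      simp [weightedLaplacian, (Finset.ne_of_mem_erase hq).symm]
  rw [Matrix.mulVec, dotProduct, ← Finset.add_sum_erase _ _ (Finset.mem_univ p), hoff,
    ← Finset.add_sum_erase _ (fun q => w p q * (φ p - φ q)) (Finset.mem_univ p)]
  simp only [weightedLaplacian, Matrix.of_apply, if_true, mul_sub, Finset.sum_sub_distrib,
    Finset.sum_neg_distrib, sub_self, Finset.sum_mul]
  ring

lemma weightedLaplacian_mulVec_dotProduct {ι : Type*} [Fintype ι] [DecidableEq ι] {w : ι → ι → ℝ}
    (hw : ∀ p q, w p q = w q p) (φ : ι → ℝ) :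
    (weightedLaplacian w *ᵥ φ) ⬝ᵥ φ = (∑ p, ∑ q, w p q * (φ p - φ q) ^ 2) / 2 := by
  have hswap : ∑ p, ∑ q, w p q * (φ p - φ q) * φ p = ∑ p, ∑ q, w p q * (φ q - φ p) * φ q := by
    rw [Finset.sum_comm]
    exact Finset.sum_congr rfl fun p _ => Finset.sum_congr rfl fun q _ => by rw [hw q p]
  have hsplit : ∑ p, ∑ q, w p q * (φ p - φ q) ^ 2 =
      ∑ p, ∑ q, w p q * (φ p - φ q) * φ p + ∑ p, ∑ q, w p q * (φ q - φ p) * φ q := by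
    simp only [← Finset.sum_add_distrib]
    exact Finset.sum_congr rfl fun p _ => Finset.sum_congr rfl fun q _ => by ring
  simp only [dotProduct, weightedLaplacian_mulVec_apply, Finset.sum_mul]
  rw [hsplit, ← hswap, add_self_div_two]

lemma boundaryLaplacian_mulVec_dotProduct [DecidableEq V] (Γ : Finset V)
    (φ : {v // v ∈ Γ} → ℝ) :
    (boundaryLaplacian G Γ *ᵥ φ) ⬝ᵥ φ = boundaryForm G Γ φ / 2 :=
  weightedLaplacian_mulVec_dotProduct (fun p q => by rw [SimpleGraph.dist_comm]) φ

lemma boundaryForm_nonneg (Γ : Finset V) (φ : {v // v ∈ Γ} → ℝ) : 0 ≤ boundaryForm G Γ φ :=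
  Finset.sum_nonneg fun _ _ => Finset.sum_nonneg fun _ _ => by positivity

end Forms

section BlockForm

variable {V : Type*} {G : SimpleGraph V} [DecidableRel G.Adj]

lemma ite_adj_nonneg (u : V → ℝ) (v w : V) :
    0 ≤ if G.Adj v w then (u v - u w) ^ 2 else 0 := by
  split_ifs <;> positivity

lemma blockForm_nonneg (u : V → ℝ) (S T : Finset V) : 0 ≤ blockForm G u S T :=
  Finset.sum_nonneg fun v _ => Finset.sum_nonneg fun w _ => ite_adj_nonneg u v w

lemma dirichlet_nonneg [Fintype V] (u : V → ℝ) : 0 ≤ dirichlet G u :=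
  blockForm_nonneg u _ _

lemma blockForm_comm (u : V → ℝ) (S T : Finset V) : blockForm G u S T = blockForm G u T S := by
  rw [blockForm, blockForm, Finset.sum_comm]
  simp only [G.adj_comm, sub_sq_comm]

lemma blockForm_union [DecidableEq V] (u : V → ℝ) {S T : Finset V} (h : Disjoint S T) :
    blockForm G u (S ∪ T) (S ∪ T) =
      blockForm G u S S + blockForm G u T T + 2 * blockForm G u S T := by
  have hright (R : Finset V) :
      blockForm G u R (S ∪ T) = blockForm G u R S + blockForm G u R T := by
    simp only [blockForm, Finset.sum_union h, Finset.sum_add_distrib]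
  have hleft : blockForm G u (S ∪ T) (S ∪ T) =
      blockForm G u S (S ∪ T) + blockForm G u T (S ∪ T) := Finset.sum_union h
  rw [hleft, hright, hright, blockForm_comm u T S]
  ring

lemma dirichlet_induce (S : Finset V) (u : V → ℝ) :
    dirichlet (G.induce {v | v ∈ S}) (fun x => u x) = blockForm G u S S := by
  have hsum (F : V → ℝ) : ∑ x : ({v | v ∈ S} : Set V), F x = ∑ v ∈ S, F v :=
    (Finset.sum_subtype S (fun _ => Iff.rfl) F).symm
  rw [dirichlet, blockForm, blockForm, ← hsum]
  refine Finset.sum_congr rfl fun x _ => ?_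
  rw [← hsum]
  rfl

lemma two_mul_sum_path_le [Fintype V] (u : V → ℝ) {v w : V} {p : G.Walk v w} (hp : p.IsPath) :
    2 * ∑ i ∈ Finset.range p.length, (u (p.getVert (i + 1)) - u (p.getVert i)) ^ 2 ≤
      dirichlet G u := by
  classical
  -- A path traverses every ordered pair of adjacent vertices at most once, in either direction.
  let F (x : V × V) : ℝ := if G.Adj x.1 x.2 then (u x.1 - u x.2) ^ 2 else 0
  let step (i : ℕ ⊕ ℕ) : V × V :=
    i.elim (fun i => (p.getVert i, p.getVert (i + 1))) fun i => (p.getVert (i + 1), p.getVert i)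
  have hadj {i : ℕ} (hi : i ∈ Finset.range p.length) : G.Adj (p.getVert i) (p.getVert (i + 1)) :=
    p.adj_getVert_succ (Finset.mem_range.1 hi)
  have hinj : Set.InjOn step ((Finset.range p.length).disjSum (Finset.range p.length)) := by
    have hget {i j : ℕ} (hi : i ≤ p.length) (hj : j ≤ p.length)
        (h : p.getVert i = p.getVert j) : i = j := hp.getVert_injOn hi hj h
    rintro (i | i) hi (j | j) hj h <;>
      simp only [Finset.mem_coe, Finset.inl_mem_disjSum, Finset.inr_mem_disjSum,
        Finset.mem_range] at hi hj <;>
      obtain ⟨h₁, h₂⟩ := Prod.ext_iff.1 h <;>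
      have h₁ := hget (by omega) (by omega) h₁ <;>
      have h₂ := hget (by omega) (by omega) h₂ <;>
      first | omega | rw [h₁] | rw [h₂]
  calc 2 * ∑ i ∈ Finset.range p.length, (u (p.getVert (i + 1)) - u (p.getVert i)) ^ 2
      = ∑ i ∈ (Finset.range p.length).disjSum (Finset.range p.length), F (step i) := by
        rw [Finset.sum_disjSum, two_mul]
        congr 1 <;> refine Finset.sum_congr rfl fun i hi => ?_
        · exact (sub_sq_comm _ _).trans (if_pos (hadj hi)).symm
        · exact (if_pos (hadj hi).symm).symm
    _ = ∑ x ∈ ((Finset.range p.length).disjSum (Finset.range p.length)).image step, F x :=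
        (Finset.sum_image hinj).symm
    _ ≤ ∑ x, F x := Finset.sum_le_sum_of_subset_of_nonneg (Finset.subset_univ _)
        fun x _ _ => ite_adj_nonneg u x.1 x.2
    _ = dirichlet G u := Fintype.sum_prod_type _

lemma two_mul_sq_sub_le_dirichlet [Fintype V] (hG : G.Preconnected) (u : V → ℝ) (v w : V) :
    2 * (u v - u w) ^ 2 ≤ Fintype.card V * dirichlet G u := by
  obtain ⟨p, hp⟩ := (hG v w).exists_isPath
  have htelescope : u w - u v =
      ∑ i ∈ Finset.range p.length, (u (p.getVert (i + 1)) - u (p.getVert i)) := by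
    rw [Finset.sum_range_sub fun i => u (p.getVert i), p.getVert_zero, p.getVert_length]
  calc 2 * (u v - u w) ^ 2
      ≤ 2 * (p.length *
          ∑ i ∈ Finset.range p.length, (u (p.getVert (i + 1)) - u (p.getVert i)) ^ 2) := by
        rw [sub_sq_comm, htelescope]
        gcongr
        simpa only [Finset.card_range] using sq_sum_le_card_mul_sum_sq (s := Finset.range p.length)
    _ = p.length *
          (2 * ∑ i ∈ Finset.range p.length, (u (p.getVert (i + 1)) - u (p.getVert i)) ^ 2) := by
        ring
    _ ≤ Fintype.card V * dirichlet G u :=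
        mul_le_mul (by exact_mod_cast hp.length_lt.le) (two_mul_sum_path_le u hp) (by positivity)
          (Nat.cast_nonneg _)

lemma two_mul_sq_sub_le_blockForm {S : Finset V} (hS : (G.induce {v | v ∈ S}).Preconnected)
    (u : V → ℝ) {v w : V} (hv : v ∈ S) (hw : w ∈ S) :
    2 * (u v - u w) ^ 2 ≤ S.card * blockForm G u S S := by
  have h := two_mul_sq_sub_le_dirichlet hS (fun x => u x) ⟨v, hv⟩ ⟨w, hw⟩
  rw [dirichlet_induce] at h
  simpa only [Set.coe_ofPred, Fintype.card_coe] using h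

lemma sq_sub_le_of_adj_blocks {S T : Finset V} {M : ℕ} (hST : Disjoint S T)
    (hS : (G.induce {v | v ∈ S}).Preconnected) (hT : (G.induce {v | v ∈ T}).Preconnected)
    (hSM : S.card ≤ M) (hTM : T.card ≤ M) (hadj : ∃ v ∈ S, ∃ w ∈ T, G.Adj v w) (u : V → ℝ)
    {r s : V} (hr : r ∈ S) (hs : s ∈ T) :
    (u r - u s) ^ 2 ≤
      M * (blockForm G u S S + blockForm G u T T + 2 * blockForm G u S T) := by
  classical
  obtain ⟨v, hv, w, hw, hvw⟩ := hadj
  have hunion : (G.induce {v | v ∈ S ∪ T}).Preconnected := by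
    have hset : {v | v ∈ S ∪ T} = {v | v ∈ S} ∪ {v | v ∈ T} := Set.ext fun _ => Finset.mem_union
    rw [hset]
    exact (SimpleGraph.connected_induce_union hS hT hv hw hvw).preconnected
  have hcard : ((S ∪ T).card : ℝ) ≤ 2 * M := by
    exact_mod_cast (Finset.card_union_le S T).trans (by omega)
  have hpath := two_mul_sq_sub_le_blockForm hunion u (Finset.mem_union_left T hr)
    (Finset.mem_union_right S hs)
  have hform := mul_le_mul_of_nonneg_right hcard (blockForm_nonneg (G := G) u (S ∪ T) (S ∪ T))
  rw [← blockForm_union u hST]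
  linarith

end BlockForm

section DisjointBlocks

variable {V X ι : Type*} [Fintype V] [Fintype ι] {G : SimpleGraph V}
  [DecidableRel G.Adj] {a : X → Finset V}

lemma sum_comp_le_of_injective [Fintype X] {x : ι → X} (hx : x.Injective) {g : X → ℝ}
    (hg : ∀ z, 0 ≤ g z) :
    ∑ i, g (x i) ≤ ∑ z, g z :=
  (Finset.sum_map Finset.univ ⟨x, hx⟩ g).symm.le.trans
    (Finset.sum_le_sum_of_subset_of_nonneg (Finset.subset_univ _) fun z _ _ => hg z)

lemma sum_sum_le_of_disjoint [Fintype X] (ha : Pairwise (Function.onFun Disjoint a)) {g : V → ℝ}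
    (hg : ∀ v, 0 ≤ g v) : ∑ x, ∑ v ∈ a x, g v ≤ ∑ v, g v := by
  classical
  rw [← Finset.sum_biUnion (ha.set_pairwise _)]
  exact Finset.sum_le_sum_of_subset_of_nonneg (Finset.subset_univ _) fun v _ _ => hg v

lemma sum_blockForm_le [Fintype X] (ha : Pairwise (Function.onFun Disjoint a)) (u : V → ℝ) :
    ∑ x, ∑ y, blockForm G u (a x) (a y) ≤ dirichlet G u := by
  calc ∑ x, ∑ y, blockForm G u (a x) (a y)
      ≤ ∑ x, ∑ v ∈ a x, ∑ w, if G.Adj v w then (u v - u w) ^ 2 else 0 := by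
        gcongr with x
        simp only [blockForm]
        rw [Finset.sum_comm]
        gcongr with v
        exact sum_sum_le_of_disjoint ha fun w => ite_adj_nonneg u v w
    _ ≤ dirichlet G u := sum_sum_le_of_disjoint ha fun v =>
        Finset.sum_nonneg fun w _ => ite_adj_nonneg u v w

lemma sum_blockForm_self_le [Finite X] (ha : Pairwise (Function.onFun Disjoint a)) (u : V → ℝ)
    {x : ι → X} (hx : x.Injective) : ∑ i, blockForm G u (a (x i)) (a (x i)) ≤ dirichlet G u := by
  cases nonempty_fintype X
  calc ∑ i, blockForm G u (a (x i)) (a (x i))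
      ≤ ∑ z, blockForm G u (a z) (a z) :=
        sum_comp_le_of_injective hx fun z => blockForm_nonneg u (a z) (a z)
    _ ≤ ∑ z, ∑ z', blockForm G u (a z) (a z') := by
        gcongr with z
        exact Finset.single_le_sum (fun z' _ => blockForm_nonneg u (a z) (a z'))
          (Finset.mem_univ z)
    _ ≤ dirichlet G u := sum_blockForm_le ha u

theorem sum_sq_representatives_le [Finite X] (ha : Pairwise (Function.onFun Disjoint a))
    (hconn : ∀ x, (G.induce {v | v ∈ a x}).Connected) {M : ℕ} (hM : ∀ x, (a x).card ≤ M)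
    (u : V → ℝ) {r : X → V} (hr : ∀ x, r x ∈ a x) {x y : ι → X} (hx : x.Injective)
    (hy : y.Injective) (hxy : ∀ i, x i ≠ y i)
    (hadj : ∀ i, ∃ v ∈ a (x i), ∃ w ∈ a (y i), G.Adj v w) :
    ∑ i, (u (r (x i)) - u (r (y i))) ^ 2 ≤ 3 * M * dirichlet G u := by
  classical
  cases nonempty_fintype X
  let ε (x y : X) : ℝ := blockForm G u (a x) (a y)
  have hε (x y : X) : 0 ≤ ε x y := blockForm_nonneg u _ _
  have hrow (i : ι) : ε (x i) (x i) + ε (x i) (y i) ≤ ∑ z, ε (x i) z := by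
    rw [← Finset.sum_pair (hxy i) (f := fun z => ε (x i) z)]
    exact Finset.sum_le_sum_of_subset_of_nonneg (Finset.subset_univ _) fun z _ _ => hε _ _
  have hsrc : ∑ i, ∑ z, ε (x i) z ≤ dirichlet G u :=
    (sum_comp_le_of_injective hx fun z => Finset.sum_nonneg fun z' _ => hε z z').trans
      (sum_blockForm_le ha u)
  calc ∑ i, (u (r (x i)) - u (r (y i))) ^ 2
      ≤ ∑ i, M * (ε (y i) (y i) + 2 * ∑ z, ε (x i) z) := by
        refine Finset.sum_le_sum fun i _ => ?_
        refine (sq_sub_le_of_adj_blocks (ha (hxy i)) (hconn _).preconnected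
          (hconn _).preconnected (hM _) (hM _) (hadj i) u (hr _) (hr _)).trans ?_
        refine mul_le_mul_of_nonneg_left ?_ (Nat.cast_nonneg M)
        change ε (x i) (x i) + ε (y i) (y i) + 2 * ε (x i) (y i) ≤ _
        linarith [hrow i, hε (x i) (x i)]
    _ = M * (∑ i, ε (y i) (y i) + 2 * ∑ i, ∑ z, ε (x i) z) := by
        rw [← Finset.mul_sum, Finset.sum_add_distrib, ← Finset.mul_sum]
    _ ≤ M * (dirichlet G u + 2 * dirichlet G u) := by
        gcongr
        exact sum_blockForm_self_le ha u hy
    _ = 3 * M * dirichlet G u := by ring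

end DisjointBlocks

lemma sum_range_inv_sq_le_two (N : ℕ) : ∑ d ∈ Finset.range N, (((d : ℝ) + 1) ^ 2)⁻¹ ≤ 2 := by
  have h := sum_Ioo_inv_sq_le (α := ℝ) 0 (N + 1)
  rw [← Finset.Ico_add_one_left_eq_Ioo, Finset.sum_Ico_eq_sum_range] at h
  simpa [add_comm] using h

section Columns

variable {P A : Type*} [Fintype P] [DecidableEq A] {C : P → A} {M : ℕ}

lemma sum_comp_le_mul_sum [Fintype A] (hM : ∀ j, (Finset.univ.filter (C · = j)).card ≤ M)
    {g : A → ℝ} (hg : ∀ i, 0 ≤ g i) : ∑ p, g (C p) ≤ M * ∑ i, g i := by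
  rw [← Finset.sum_fiberwise Finset.univ C, Finset.mul_sum]
  refine Finset.sum_le_sum fun i _ => ?_
  rw [Finset.sum_congr rfl
    (fun p hp => by rw [(Finset.mem_filter.1 hp).2]), Finset.sum_const, nsmul_eq_mul]
  exact mul_le_mul_of_nonneg_right (by exact_mod_cast hM i) (hg i)

lemma sum_ite_eq_le_mul (hM : ∀ j, (Finset.univ.filter (C · = j)).card ≤ M) (j : A) {x : ℝ}
    (hx : 0 ≤ x) : ∑ q, (if C q = j then x else 0) ≤ M * x := by
  rw [← Finset.sum_filter, Finset.sum_const, nsmul_eq_mul]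
  exact mul_le_mul_of_nonneg_right (by exact_mod_cast hM j) hx

/-- For points `p` distributed over the columns `C p`, the sum of the squared differences of `φ`
over the pairs whose columns differ by the shift `t`. -/
def columnSq [Add A] (C : P → A) (φ : P → ℝ) (t : A) : ℝ :=
  ∑ p, ∑ q, if C q = C p + t then (φ p - φ q) ^ 2 else 0

lemma columnSq_le [Fintype A] [AddGroup A] (hM : ∀ j, (Finset.univ.filter (C · = j)).card ≤ M)
    (φ : P → ℝ) (g : A → ℝ) (t : A) :
    columnSq C φ t ≤
      6 * M * ∑ p, (φ p - g (C p)) ^ 2 + 3 * M ^ 2 * ∑ i, (g (i + t) - g i) ^ 2 := by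
  have hpt (p q : P) : (if C q = C p + t then (φ p - φ q) ^ 2 else 0) ≤
      3 * (if C q = C p + t then (φ p - g (C p)) ^ 2 else 0) +
        3 * (if C q = C p + t then (g (C p + t) - g (C p)) ^ 2 else 0) +
        3 * (if C p = C q - t then (φ q - g (C q)) ^ 2 else 0) := by
    simp only [eq_sub_iff_add_eq, eq_comm (a := C p + t)]
    split_ifs with h
    · rw [← h, sub_sq_comm (φ p) (g _), sub_sq_comm (g (C q)), sub_sq_comm (φ q) (g _)]
      exact sq_sub_le_three_mul _ _ _ _
    · simp
  have hsource : ∑ p, ∑ q, (if C q = C p + t then (φ p - g (C p)) ^ 2 else 0) ≤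
      M * ∑ p, (φ p - g (C p)) ^ 2 := by
    rw [Finset.mul_sum]
    exact Finset.sum_le_sum fun p _ => sum_ite_eq_le_mul hM _ (sq_nonneg _)
  have hshift : ∑ p, ∑ q, (if C q = C p + t then (g (C p + t) - g (C p)) ^ 2 else 0) ≤
      M * (M * ∑ i, (g (i + t) - g i) ^ 2) := by
    calc _ ≤ ∑ p, M * (g (C p + t) - g (C p)) ^ 2 :=
          Finset.sum_le_sum fun p _ => sum_ite_eq_le_mul hM _ (sq_nonneg _)
      _ ≤ _ := by
          rw [← Finset.mul_sum]
          exact mul_le_mul_of_nonneg_left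
            (sum_comp_le_mul_sum hM (g := fun i => (g (i + t) - g i) ^ 2) fun i => sq_nonneg _)
            (Nat.cast_nonneg M)
  have htarget : ∑ p, ∑ q, (if C p = C q - t then (φ q - g (C q)) ^ 2 else 0) ≤
      M * ∑ p, (φ p - g (C p)) ^ 2 := by
    rw [Finset.sum_comm, Finset.mul_sum]
    exact Finset.sum_le_sum fun p _ => sum_ite_eq_le_mul hM _ (sq_nonneg _)
  have hsum : columnSq C φ t ≤ _ :=
    Finset.sum_le_sum fun p _ => Finset.sum_le_sum fun q _ => hpt p q
  simp only [Finset.sum_add_distrib, ← Finset.mul_sum] at hsum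
  linarith

lemma inv_sq_mul_le_sum {k d N : ℕ} (hdk : d ≤ k) (hdN : d ≤ N) {f : ℕ → ℝ} (hf : ∀ d, 0 ≤ f d)
    {y : ℝ} (hy : 0 ≤ y) (hyf : y ≤ f d) :
    ((k : ℝ) ^ 2)⁻¹ * y ≤ f 0 + ∑ d ∈ Finset.range N, f (d + 1) / ((d : ℝ) + 1) ^ 2 := by
  have hterm (d : ℕ) : 0 ≤ f (d + 1) / ((d : ℝ) + 1) ^ 2 := div_nonneg (hf _) (by positivity)
  obtain _ | d := d
  · have hk : ((k : ℝ) ^ 2)⁻¹ ≤ 1 := by exact_mod_cast Nat.cast_inv_le_one (k ^ 2)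
    have hsum := Finset.sum_nonneg fun d (_ : d ∈ Finset.range N) => hterm d
    linarith [mul_le_of_le_one_left hy hk]
  · calc ((k : ℝ) ^ 2)⁻¹ * y ≤ (((d : ℝ) + 1) ^ 2)⁻¹ * f (d + 1) := by
          gcongr
          exact_mod_cast hdk
      _ = f (d + 1) / ((d : ℝ) + 1) ^ 2 := inv_mul_eq_div _ _
      _ ≤ ∑ d ∈ Finset.range N, f (d + 1) / ((d : ℝ) + 1) ^ 2 :=
          Finset.single_le_sum (fun d _ => hterm d) (Finset.mem_range.2 hdN)
      _ ≤ _ := le_add_of_nonneg_left (hf 0)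

lemma sum_inv_sq_mul_le_columnSq [AddMonoid A] (δ : P → P → ℕ) (e : A) {N : ℕ}
    (hδ : ∀ p q, ∃ d ≤ δ p q, d ≤ N ∧ (C q = C p + d • e ∨ C p = C q + d • e)) (φ : P → ℝ) :
    ∑ p, ∑ q, ((δ p q : ℝ) ^ 2)⁻¹ * (φ p - φ q) ^ 2 ≤
      2 * (columnSq C φ 0 +
        ∑ d ∈ Finset.range N, columnSq C φ ((d + 1) • e) / ((d : ℝ) + 1) ^ 2) := by
  let s (d : ℕ) (p q : P) : ℝ := if C q = C p + d • e then (φ p - φ q) ^ 2 else 0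
  have hs (d : ℕ) (p q : P) : 0 ≤ s d p q := by dsimp only [s]; split_ifs <;> positivity
  have hpt (p q : P) : ((δ p q : ℝ) ^ 2)⁻¹ * (φ p - φ q) ^ 2 ≤ s 0 p q + s 0 q p +
      ∑ d ∈ Finset.range N, (s (d + 1) p q + s (d + 1) q p) / ((d : ℝ) + 1) ^ 2 := by
    obtain ⟨d, hdδ, hdN, hd⟩ := hδ p q
    refine inv_sq_mul_le_sum hdδ hdN (f := fun d => s d p q + s d q p)
      (fun d => add_nonneg (hs d p q) (hs d q p)) (sq_nonneg _) ?_
    rcases hd with hd | hd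
    · exact (if_pos hd).symm.le.trans (le_add_of_nonneg_right (hs d q p))
    · rw [sub_sq_comm]
      exact (if_pos hd).symm.le.trans (le_add_of_nonneg_left (hs d p q))
  have hsum (d : ℕ) : ∑ p, ∑ q, (s d p q + s d q p) = 2 * columnSq C φ (d • e) := by
    simp only [Finset.sum_add_distrib]
    rw [Finset.sum_comm (f := fun p q => s d q p), ← two_mul]
    rfl
  calc ∑ p, ∑ q, ((δ p q : ℝ) ^ 2)⁻¹ * (φ p - φ q) ^ 2
      ≤ ∑ p, ∑ q, (s 0 p q + s 0 q p) + ∑ d ∈ Finset.range N,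
          (∑ p, ∑ q, (s (d + 1) p q + s (d + 1) q p)) / ((d : ℝ) + 1) ^ 2 := by
        simp only [Finset.sum_div]
        rw [Finset.sum_comm (s := Finset.range N)]
        simp only [Finset.sum_comm (s := Finset.range N), ← Finset.sum_add_distrib]
        exact Finset.sum_le_sum fun p _ => Finset.sum_le_sum fun q _ => hpt p q
    _ = _ := by
        simp only [hsum, mul_div_assoc, ← Finset.mul_sum, zero_smul]
        ring

lemma sum_inv_sq_mul_le_shiftForm [Fintype A] [AddGroup A]
    (hM : ∀ j, (Finset.univ.filter (C · = j)).card ≤ M) (δ : P → P → ℕ) (e : A) {N : ℕ}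
    (hδ : ∀ p q, ∃ d ≤ δ p q, d ≤ N ∧ (C q = C p + d • e ∨ C p = C q + d • e)) (φ : P → ℝ)
    (g : A → ℝ) :
    ∑ p, ∑ q, ((δ p q : ℝ) ^ 2)⁻¹ * (φ p - φ q) ^ 2 ≤
      36 * M * ∑ p, (φ p - g (C p)) ^ 2 + 6 * M ^ 2 * shiftForm g e N := by
  set D := ∑ p, (φ p - g (C p)) ^ 2
  have _ : 0 ≤ D := Finset.sum_nonneg fun p _ => sq_nonneg _
  have hzero : columnSq C φ 0 ≤ 6 * M * D := by simpa using columnSq_le hM φ g 0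
  calc ∑ p, ∑ q, ((δ p q : ℝ) ^ 2)⁻¹ * (φ p - φ q) ^ 2
      ≤ 2 * (columnSq C φ 0 + ∑ d ∈ Finset.range N,
          columnSq C φ ((d + 1) • e) / ((d : ℝ) + 1) ^ 2) :=
        sum_inv_sq_mul_le_columnSq δ e hδ φ
    _ ≤ 2 * (6 * M * D + ∑ d ∈ Finset.range N,
          (6 * M * D + 3 * M ^ 2 * shiftSq g e (d + 1)) / ((d : ℝ) + 1) ^ 2) := by
        gcongr
        exact columnSq_le hM φ g _
    _ = 12 * M * D + 12 * M * D * ∑ d ∈ Finset.range N, (((d : ℝ) + 1) ^ 2)⁻¹ +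
          6 * M ^ 2 * shiftForm g e N := by
        simp only [shiftForm, div_eq_mul_inv, add_mul, Finset.sum_add_distrib, mul_assoc,
          ← Finset.mul_sum]
        ring
    _ ≤ 12 * M * D + 12 * M * D * 2 + 6 * M ^ 2 * shiftForm g e N := by
        gcongr
        exact sum_range_inv_sq_le_two N
    _ = 36 * M * D + 6 * M ^ 2 * shiftForm g e N := by ring

end Columns

lemma exists_nsmul_le_half {n : ℕ} (i j : Fin (n + 2)) :
    ∃ e : ℕ, 2 * e ≤ n + 2 ∧ (j = i + e • 1 ∨ i = j + e • 1) := by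
  by_cases hij : 2 * (j - i).val ≤ n + 2
  · exact ⟨_, hij, Or.inl (add_val_sub_nsmul_one i j).symm⟩
  · refine ⟨(i - j).val, ?_, Or.inr (add_val_sub_nsmul_one j i).symm⟩
    have hne : j - i ≠ 0 := fun h => hij (by rw [h]; simp)
    have hneg := Fin.val_neg (j - i)
    rw [if_neg hne, neg_sub] at hneg
    omega

namespace IsAggregationPartition

variable {V : Type*} {G : SimpleGraph V} {Γ : Finset V} {M n m : ℕ}
  {H : SimpleGraph (Fin (n + 2) × Fin (m + 2))} {a : Fin (n + 2) × Fin (m + 2) → Finset V}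
  {aStar : Finset V} {C : V → Fin (n + 2)}

lemma exists_nsmul_of_walk (hP : IsAggregationPartition G Γ M H a aStar)
    (hstar : H ≤ gridStar (n + 2) (m + 2)) (hC : ∀ v ∈ Γ, v ∈ a (C v, 0))
    {p q : ({v | v ∈ Γ} : Set V)} (w : (G.induce {v | v ∈ Γ}).Walk p q) :
    ∃ s t : ℕ, s + t ≤ w.length ∧ C p + s • 1 = C q + t • 1 := by
  induction w with
  | nil => exact ⟨0, 0, le_rfl, rfl⟩
  | @cons x y z h w ih =>
    obtain ⟨s, t, hst, he⟩ := ih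
    have hxy : G.Adj x y := h
    rw [SimpleGraph.Walk.length_cons]
    rcases hP.column_adj hstar hC x.2 y.2 hxy with h | h | h
    · exact ⟨s, t, by omega, by rw [← he, h]⟩
    · exact ⟨s + 1, t, by omega, by rw [← he, h, succ_nsmul]; abel⟩
    · exact ⟨s, t + 1, by omega, by rw [h, succ_nsmul, ← add_assoc, ← he]; abel⟩

lemma exists_nsmul_le_dist (hP : IsAggregationPartition G Γ M H a aStar)
    (hstar : H ≤ gridStar (n + 2) (m + 2)) (hC : ∀ v ∈ Γ, v ∈ a (C v, 0))
    (hΓ : (G.induce {v | v ∈ Γ}).Preconnected) (p q : {v // v ∈ Γ}) :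
    ∃ e ≤ (G.induce {v | v ∈ Γ}).dist p q, 2 * e ≤ n + 2 ∧
      (C q = C p + e • 1 ∨ C p = C q + e • 1) := by
  obtain ⟨w, hw⟩ := (hΓ p q).exists_walk_length_eq_dist
  obtain ⟨s, t, hst, he⟩ := hP.exists_nsmul_of_walk hstar hC w
  obtain ⟨e, hhalf, heC⟩ := exists_nsmul_le_half (C p) (C q)
  by_cases hcase : e ≤ (G.induce {v | v ∈ Γ}).dist p q
  · exact ⟨e, hcase, hhalf, heC⟩
  · rcases le_total s t with h | h <;> obtain ⟨d, rfl⟩ := Nat.exists_eq_add_of_le h <;>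
      rw [add_comm _ d, add_nsmul, ← add_assoc] at he
    · exact ⟨d, by omega, by omega, Or.inr (add_right_cancel he)⟩
    · exact ⟨d, by omega, by omega, Or.inl (add_right_cancel he).symm⟩

lemma card_column_le (hP : IsAggregationPartition G Γ M H a aStar)
    (hC : ∀ v ∈ Γ, v ∈ a (C v, 0)) (j : Fin (n + 2)) :
    (Finset.univ.filter fun q : {v // v ∈ Γ} => C q = j).card ≤ M := by
  refine (Finset.card_le_card_of_injOn Subtype.val (fun q hq => ?_)
    Subtype.val_injective.injOn).trans (hP.card_le (j, 0))
  have hq' := hC q q.2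
  rwa [(Finset.mem_filter.1 hq).2] at hq'

lemma one_le_bound (hP : IsAggregationPartition G Γ M H a aStar) : 1 ≤ M := by
  obtain ⟨v, -, hv⟩ := hP.boundary_meets 0 0 rfl
  exact (Finset.card_pos.2 ⟨v, hv⟩).trans_le (hP.card_le _)

lemma exists_representatives (hP : IsAggregationPartition G Γ M H a aStar) :
    ∃ r : Fin (n + 2) × Fin (m + 2) → V, ∀ x, r x ∈ a x := by
  have hne (x : Fin (n + 2) × Fin (m + 2)) := (hP.connected x).nonempty
  exact ⟨fun x => (hne x).some, fun x => (hne x).some.2⟩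

lemma pairwise_disjoint (hP : IsAggregationPartition G Γ M H a aStar) :
    Pairwise (Function.onFun Disjoint a) :=
  fun x y => hP.disjoint x y

lemma exists_adj_of_grid_adj (hP : IsAggregationPartition G Γ M H a aStar)
    (hgrid : grid (n + 2) (m + 2) ≤ H) {x y : Fin (n + 2) × Fin (m + 2)}
    (h : (grid (n + 2) (m + 2)).Adj x y) : ∃ v ∈ a x, ∃ w ∈ a y, G.Adj v w :=
  (hP.adj_iff x y h.ne).1 (hgrid h)

variable [Fintype V] [DecidableRel G.Adj] {r : Fin (n + 2) × Fin (m + 2) → V}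

lemma sum_horizontal_le (hP : IsAggregationPartition G Γ M H a aStar)
    (hgrid : grid (n + 2) (m + 2) ≤ H) (hr : ∀ x, r x ∈ a x) (u : V → ℝ) :
    ∑ j, ∑ i, (u (r (i + 1, j)) - u (r (i, j))) ^ 2 ≤ 3 * M * dirichlet G u := by
  have hadj (q : Fin (m + 2) × Fin (n + 2)) :
      (grid (n + 2) (m + 2)).Adj (q.2 + 1, q.1) (q.2, q.1) := (grid_adj_add_one _ _).symm
  rw [← Fintype.sum_prod_type' fun j i => (u (r (i + 1, j)) - u (r (i, j))) ^ 2]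
  refine sum_sq_representatives_le hP.pairwise_disjoint hP.connected hP.card_le u hr
    (x := fun q : Fin (m + 2) × Fin (n + 2) => (q.2 + 1, q.1)) (y := fun q => (q.2, q.1))
    (fun q q' h => ?_) (fun q q' h => ?_) (fun q => (hadj q).ne)
    fun q => hP.exists_adj_of_grid_adj hgrid (hadj q)
  all_goals
    simp only [Prod.mk.injEq, add_left_inj] at h
    exact Prod.ext h.2 h.1

lemma sum_vertical_le (hP : IsAggregationPartition G Γ M H a aStar)
    (hgrid : grid (n + 2) (m + 2) ≤ H) (hr : ∀ x, r x ∈ a x) (u : V → ℝ) :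
    ∑ j : Fin (m + 1), ∑ i, (u (r (i, j.succ)) - u (r (i, j.castSucc))) ^ 2 ≤
      3 * M * dirichlet G u := by
  have hadj (q : Fin (m + 1) × Fin (n + 2)) :
      (grid (n + 2) (m + 2)).Adj (q.2, q.1.succ) (q.2, q.1.castSucc) :=
    (grid_adj_castSucc_succ _ _).symm
  rw [← Fintype.sum_prod_type' fun (j : Fin (m + 1)) i =>
    (u (r (i, j.succ)) - u (r (i, j.castSucc))) ^ 2]
  refine sum_sq_representatives_le hP.pairwise_disjoint hP.connected hP.card_le u hr
    (x := fun q : Fin (m + 1) × Fin (n + 2) => (q.2, q.1.succ))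
    (y := fun q => (q.2, q.1.castSucc)) (fun q q' h => ?_) (fun q q' h => ?_)
    (fun q => (hadj q).ne) fun q => hP.exists_adj_of_grid_adj hgrid (hadj q)
  all_goals
    simp only [Prod.mk.injEq, Fin.succ_inj, Fin.castSucc_inj] at h
    exact Prod.ext h.2 h.1

lemma two_mul_sum_boundary_sub_representative_le (hP : IsAggregationPartition G Γ M H a aStar)
    (hC : ∀ v ∈ Γ, v ∈ a (C v, 0)) (hr : ∀ x, r x ∈ a x) (u : V → ℝ) :
    2 * ∑ p : {v // v ∈ Γ}, (u p - u (r (C p, 0))) ^ 2 ≤ M ^ 2 * dirichlet G u := by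
  have hblock (i : Fin (n + 2)) : 0 ≤ blockForm G u (a (i, 0)) (a (i, 0)) :=
    blockForm_nonneg u _ _
  calc 2 * ∑ p : {v // v ∈ Γ}, (u p - u (r (C p, 0))) ^ 2
      ≤ ∑ p : {v // v ∈ Γ}, M * blockForm G u (a (C p, 0)) (a (C p, 0)) := by
        rw [Finset.mul_sum]
        refine Finset.sum_le_sum fun p _ => ?_
        refine (two_mul_sq_sub_le_blockForm (hP.connected _).preconnected u (hC p p.2)
          (hr _)).trans ?_
        gcongr
        · exact hblock _
        · exact hP.card_le _
    _ ≤ M * (M * ∑ i, blockForm G u (a (i, 0)) (a (i, 0))) := by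
        rw [← Finset.mul_sum]
        gcongr
        exact sum_comp_le_mul_sum (C := fun p : {v // v ∈ Γ} => C p) (hP.card_column_le hC)
          (g := fun i => blockForm G u (a (i, 0)) (a (i, 0))) hblock
    _ ≤ M * (M * dirichlet G u) := by
        gcongr
        exact sum_blockForm_self_le hP.pairwise_disjoint u (x := fun i => (i, 0))
          fun i j h => congrArg Prod.fst h
    _ = M ^ 2 * dirichlet G u := by ring

lemma shiftForm_representatives_le (hP : IsAggregationPartition G Γ M H a aStar)
    (hgrid : grid (n + 2) (m + 2) ≤ H) (hr : ∀ x, r x ∈ a x) (c : ℕ) (u : V → ℝ) :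
    shiftForm (fun i => u (r (i, 0))) 1 (c * (m + 2)) ≤
      3 * c * (3 * M * dirichlet G u) + 24 * (3 * M * dirichlet G u) := by
  let U (i : Fin (n + 2)) (j : ℕ) : ℝ := if h : j < m + 2 then u (r (i, ⟨j, h⟩)) else 0
  have hU (i : Fin (n + 2)) (j : Fin (m + 2)) : U i j = u (r (i, j)) := dif_pos j.2
  have hUrow : (fun i => u (r (i, 0))) = (U · 0) := funext fun i => (hU i 0).symm
  have hhor := hP.sum_horizontal_le hgrid hr u
  have hver := hP.sum_vertical_le hgrid hr u
  simp only [← hU, Fin.val_succ, Fin.val_castSucc] at hhor hver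
  rw [hUrow]
  refine (cylinder_trace U 1 c (m + 1)).trans ?_
  rw [Finset.sum_range, Finset.sum_range]
  gcongr

theorem boundaryForm_le_dirichlet (hP : IsAggregationPartition G Γ M H a aStar)
    (hgrid : grid (n + 2) (m + 2) ≤ H) (hstar : H ≤ gridStar (n + 2) (m + 2))
    (hC : ∀ v ∈ Γ, v ∈ a (C v, 0)) (hΓ : (G.induce {v | v ∈ Γ}).Preconnected) {c : ℕ}
    (hc : n + 2 < 2 * c * (m + 2)) {X : ℝ} (hcX : 3 * (c : ℝ) ≤ X) (hX : 36 ≤ X) (u : V → ℝ) :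
    boundaryForm G Γ (fun p => u p) ≤ 36 * M ^ 3 * X * dirichlet G u := by
  obtain ⟨r, hr⟩ := hP.exists_representatives
  have hE : (0 : ℝ) ≤ M ^ 3 * dirichlet G u := mul_nonneg (by positivity) (dirichlet_nonneg u)
  have hdist (p q : {v // v ∈ Γ}) : ∃ d ≤ (G.induce {v | v ∈ Γ}).dist p q, d ≤ c * (m + 2) ∧
      (C q = C p + d • 1 ∨ C p = C q + d • 1) := by
    obtain ⟨d, hd, hhalf, hCd⟩ := hP.exists_nsmul_le_dist hstar hC hΓ p q
    rw [mul_assoc] at hc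
    exact ⟨d, hd, by omega, hCd⟩
  calc boundaryForm G Γ (fun p => u p)
      ≤ 36 * M * ∑ p : {v // v ∈ Γ}, (u p - u (r (C p, 0))) ^ 2 +
          6 * M ^ 2 * shiftForm (fun i => u (r (i, 0))) 1 (c * (m + 2)) :=
        sum_inv_sq_mul_le_shiftForm (C := fun p : {v // v ∈ Γ} => C p) (hP.card_column_le hC) _ 1
          hdist (fun p => u p) fun i => u (r (i, 0))
    _ ≤ 36 * M * (M ^ 2 / 2 * dirichlet G u) +
          6 * M ^ 2 * (3 * c * (3 * M * dirichlet G u) + 24 * (3 * M * dirichlet G u)) := by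
        gcongr
        · linarith [hP.two_mul_sum_boundary_sub_representative_le hC hr u]
        · exact hP.shiftForm_representatives_le hgrid hr c u
    _ = (18 * (3 * c) + 450) * (M ^ 3 * dirichlet G u) := by ring
    _ ≤ 36 * X * (M ^ 3 * dirichlet G u) := by gcongr; linarith
    _ = 36 * M ^ 3 * X * dirichlet G u := by ring

end IsAggregationPartition

section GridForm

lemma dirichlet_le_of_cover {X E : Type*} [Fintype X] [Fintype E] {K : SimpleGraph X}
    [DecidableRel K.Adj] {s t : E → X}
    (hK : ∀ ⦃x y⦄, K.Adj x y → ∃ e, (s e = x ∧ t e = y) ∨ (t e = x ∧ s e = y)) (w : X → ℝ) :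
    dirichlet K w ≤ 2 * ∑ e, (w (t e) - w (s e)) ^ 2 := by
  classical
  let ends : E ⊕ E → X × X := Sum.elim (fun e => (s e, t e)) fun e => (t e, s e)
  have hcover : (Finset.univ.filter fun x : X × X => K.Adj x.1 x.2) ⊆ Finset.univ.image ends := by
    intro x hx
    obtain ⟨e, he | he⟩ := hK (Finset.mem_filter.1 hx).2
    · exact Finset.mem_image.2 ⟨Sum.inl e, Finset.mem_univ _, Prod.ext he.1 he.2⟩
    · exact Finset.mem_image.2 ⟨Sum.inr e, Finset.mem_univ _, Prod.ext he.1 he.2⟩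
  calc dirichlet K w
      = ∑ x : X × X with K.Adj x.1 x.2, (w x.1 - w x.2) ^ 2 := by
        rw [Finset.sum_filter, Fintype.sum_prod_type]
        rfl
    _ ≤ ∑ x ∈ Finset.univ.image ends, (w x.1 - w x.2) ^ 2 :=
        Finset.sum_le_sum_of_subset_of_nonneg hcover fun _ _ _ => sq_nonneg _
    _ ≤ ∑ e, (w (ends e).1 - w (ends e).2) ^ 2 :=
        Finset.sum_image_le_of_nonneg fun _ _ => sq_nonneg _
    _ = 2 * ∑ e, (w (t e) - w (s e)) ^ 2 := by
        rw [Fintype.sum_sum_type, two_mul]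
        simp only [ends, Sum.elim_inl, Sum.elim_inr, sub_sq_comm]

variable {n m : ℕ} {x y : Fin (n + 2) × Fin (m + 2)}

lemma fst_eq_of_gridStar_adj (h : (gridStar (n + 2) (m + 2)).Adj x y) :
    ∃ δ : Fin 3, y.1 = x.1 + ![0, 1, -1] δ := by
  have hcycle (h : (SimpleGraph.cycleGraph (n + 2)).Adj x.1 y.1) :
      ∃ δ : Fin 3, y.1 = x.1 + ![0, 1, -1] δ := by
    rcases SimpleGraph.cycleGraph_adj.1 h with h | h
    · exact ⟨2, eq_add_neg_of_add_eq (by rw [← h, add_sub_cancel])⟩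
    · exact ⟨1, (sub_eq_iff_eq_add'.1 h)⟩
  rcases h with (⟨h, -⟩ | ⟨-, h⟩) | ⟨h, -⟩
  · exact hcycle h
  · exact ⟨0, h.symm.trans (add_zero _).symm⟩
  · exact hcycle h

lemma snd_eq_of_gridStar_adj (h : (gridStar (n + 2) (m + 2)).Adj x y) :
    y.2 = x.2 ∨ ∃ k : Fin (m + 1),
      (x.2 = k.castSucc ∧ y.2 = k.succ) ∨ (y.2 = k.castSucc ∧ x.2 = k.succ) := by
  have hpath (h : (SimpleGraph.pathGraph (m + 2)).Adj x.2 y.2) : ∃ k : Fin (m + 1),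
      (x.2 = k.castSucc ∧ y.2 = k.succ) ∨ (y.2 = k.castSucc ∧ x.2 = k.succ) := by
    rcases SimpleGraph.pathGraph_adj.1 h with h | h
    · exact ⟨⟨x.2, by omega⟩, Or.inl ⟨rfl, Fin.ext h.symm⟩⟩
    · exact ⟨⟨y.2, by omega⟩, Or.inr ⟨rfl, Fin.ext h.symm⟩⟩
  rcases h with (⟨-, h⟩ | ⟨h, -⟩) | ⟨-, h⟩
  · exact Or.inl h.symm
  · exact Or.inr (hpath h)
  · exact Or.inr (hpath h)

lemma sum_diagonal_le (w : Fin (n + 2) × Fin (m + 2) → ℝ) {δ : Fin (n + 2)}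
    (hδ : ∀ j, ∑ i, (w (i + δ, j) - w (i, j)) ^ 2 = ∑ i, (w (i + 1, j) - w (i, j)) ^ 2) :
    ∑ j : Fin (m + 1), ∑ i, (w (i + δ, j.succ) - w (i, j.castSucc)) ^ 2 ≤
      2 * ∑ j, ∑ i, (w (i + 1, j) - w (i, j)) ^ 2 +
        2 * ∑ j : Fin (m + 1), ∑ i, (w (i, j.succ) - w (i, j.castSucc)) ^ 2 := by
  calc ∑ j : Fin (m + 1), ∑ i, (w (i + δ, j.succ) - w (i, j.castSucc)) ^ 2
      ≤ ∑ j : Fin (m + 1), ∑ i, (2 * (w (i + δ, j.succ) - w (i, j.succ)) ^ 2 +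
          2 * (w (i, j.succ) - w (i, j.castSucc)) ^ 2) := by
        refine Finset.sum_le_sum fun j _ => Finset.sum_le_sum fun i _ => ?_
        rw [← mul_add, ← sub_add_sub_cancel (w (i + δ, j.succ)) (w (i, j.succ))]
        exact add_sq_le
    _ = 2 * ∑ j : Fin (m + 1), ∑ i, (w (i + 1, j.succ) - w (i, j.succ)) ^ 2 +
          2 * ∑ j : Fin (m + 1), ∑ i, (w (i, j.succ) - w (i, j.castSucc)) ^ 2 := by
        simp only [Finset.sum_add_distrib, ← Finset.mul_sum, hδ]
    _ ≤ _ := by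
        rw [Fin.sum_univ_succ fun j => ∑ i, (w (i + 1, j) - w (i, j)) ^ 2]
        gcongr
        exact le_add_of_nonneg_left (Finset.sum_nonneg fun _ _ => sq_nonneg _)

lemma dirichlet_gridStar_le [DecidableRel (gridStar (n + 2) (m + 2)).Adj]
    (w : Fin (n + 2) × Fin (m + 2) → ℝ) :
    dirichlet (gridStar (n + 2) (m + 2)) w ≤
      10 * (∑ j, ∑ i, (w (i + 1, j) - w (i, j)) ^ 2 +
        ∑ j : Fin (m + 1), ∑ i, (w (i, j.succ) - w (i, j.castSucc)) ^ 2) := by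
  -- The edges of `G*` run along the cycles, or to the next row, shifted by `0`, `1` or `-1`.
  let source : (Fin (m + 2) × Fin (n + 2)) ⊕ (Fin 3 × Fin (m + 1) × Fin (n + 2)) → _ :=
    Sum.elim (fun e => (e.2, e.1)) fun e => (e.2.2, e.2.1.castSucc)
  let target : (Fin (m + 2) × Fin (n + 2)) ⊕ (Fin 3 × Fin (m + 1) × Fin (n + 2)) → _ :=
    Sum.elim (fun e => (e.2 + 1, e.1)) fun e => (e.2.2 + ![0, 1, -1] e.1, e.2.1.succ)
  have hcover ⦃x y⦄ (h : (gridStar (n + 2) (m + 2)).Adj x y) :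
      ∃ e, (source e = x ∧ target e = y) ∨ (target e = x ∧ source e = y) := by
    rcases snd_eq_of_gridStar_adj h with hrow | ⟨k, ⟨hx, hy⟩ | ⟨hy, hx⟩⟩
    · have h' : (gridStar (n + 2) (m + 2)).Adj (x.1, x.2) (y.1, x.2) := by
        rwa [show y = (y.1, x.2) from Prod.ext rfl hrow] at h
      rcases eq_add_one_of_gridStar_adj h' with h' | h'
      · exact ⟨Sum.inl (x.2, x.1), Or.inl ⟨rfl, Prod.ext h'.symm hrow.symm⟩⟩
      · exact ⟨Sum.inl (y.2, y.1), Or.inr ⟨Prod.ext h'.symm hrow, rfl⟩⟩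
    · obtain ⟨δ, hδ⟩ := fst_eq_of_gridStar_adj h
      exact ⟨Sum.inr (δ, k, x.1), Or.inl ⟨Prod.ext rfl hx.symm, Prod.ext hδ.symm hy.symm⟩⟩
    · obtain ⟨δ, hδ⟩ := fst_eq_of_gridStar_adj h.symm
      exact ⟨Sum.inr (δ, k, y.1), Or.inr ⟨Prod.ext hδ.symm hx.symm, Prod.ext rfl hy.symm⟩⟩
  have hneg (j : Fin (m + 2)) :
      ∑ i, (w (i + -1, j) - w (i, j)) ^ 2 = ∑ i, (w (i + 1, j) - w (i, j)) ^ 2 := by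
    rw [← sum_comp_add_right (fun i => (w (i + -1, j) - w (i, j)) ^ 2) 1]
    simp only [add_neg_cancel_right, sub_sq_comm]
  have hforward := sum_diagonal_le w fun j => rfl
  have hbackward := sum_diagonal_le w hneg
  refine (dirichlet_le_of_cover hcover w).trans ?_
  simp only [Fintype.sum_sum_type, Fintype.sum_prod_type, Fin.sum_univ_three, source, target,
    Sum.elim_inl, Sum.elim_inr, Matrix.cons_val, add_zero]
  linarith

end GridForm

section Degree

variable {V : Type*} [Fintype V] {G : SimpleGraph V} [DecidableRel G.Adj]

lemma dirichlet_le_add_sub (u f : V → ℝ) :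
    dirichlet G u ≤ 2 * dirichlet G f + 2 * dirichlet G (fun v => u v - f v) := by
  simp only [dirichlet, blockForm, Finset.mul_sum, ← Finset.sum_add_distrib]
  refine Finset.sum_le_sum fun v _ => Finset.sum_le_sum fun w _ => ?_
  split_ifs
  · linarith [add_sq_le (a := f v - f w) (b := u v - f v - (u w - f w)),
      congrArg (· ^ 2) (show f v - f w + (u v - f v - (u w - f w)) = u v - u w by ring)]
  · simp

lemma dirichlet_le_degree (g : V → ℝ) : dirichlet G g ≤ 4 * ∑ v, G.degree v * g v ^ 2 := by
  have hdegree (v : V) : ∑ w, (if G.Adj v w then g v ^ 2 else 0) = G.degree v * g v ^ 2 := by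
    rw [← Finset.sum_filter, Finset.sum_const, nsmul_eq_mul,
      ← SimpleGraph.card_neighborFinset_eq_degree, SimpleGraph.neighborFinset_eq_filter]
  have hswap : ∑ v, ∑ w, (if G.Adj v w then g w ^ 2 else 0) =
      ∑ v, ∑ w, (if G.Adj v w then g v ^ 2 else 0) := by
    rw [Finset.sum_comm]
    simp only [G.adj_comm]
  calc dirichlet G g
      ≤ ∑ v, ∑ w, (2 * (if G.Adj v w then g v ^ 2 else 0) +
        2 * (if G.Adj v w then g w ^ 2 else 0)) := by
        refine Finset.sum_le_sum fun v _ => Finset.sum_le_sum fun w _ => ?_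
        split_ifs
        · linarith [sq_nonneg (g v + g w)]
        · simp
    _ = 4 * ∑ v, G.degree v * g v ^ 2 := by
        simp only [Finset.sum_add_distrib, ← Finset.mul_sum, hswap, hdegree]
        ring

end Degree

section Pullback

open Classical in
/-- The function on `V` equal to `w y` on the block `a y`, and to `x` outside the blocks. -/
noncomputable def pullback {V X : Type*} (a : X → Finset V) (w : X → ℝ) (x : ℝ) (v : V) : ℝ :=
  if h : ∃ y, v ∈ a y then w h.choose else x

namespace IsAggregationPartition

variable {V : Type*} {G : SimpleGraph V} {Γ : Finset V} {M n m : ℕ}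
  {H : SimpleGraph (Fin (n + 2) × Fin (m + 2))} {a : Fin (n + 2) × Fin (m + 2) → Finset V}
  {aStar : Finset V} {C : V → Fin (n + 2)}

lemma pullback_of_mem (hP : IsAggregationPartition G Γ M H a aStar)
    (w : Fin (n + 2) × Fin (m + 2) → ℝ) (x : ℝ) {v : V} {y : Fin (n + 2) × Fin (m + 2)}
    (hv : v ∈ a y) : pullback a w x v = w y := by
  have h : ∃ y, v ∈ a y := ⟨y, hv⟩
  rw [pullback, dif_pos h, hP.eq_of_mem h.choose_spec hv]

lemma pullback_of_mem_star (hP : IsAggregationPartition G Γ M H a aStar)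
    (w : Fin (n + 2) × Fin (m + 2) → ℝ) (x : ℝ) {v : V} (hv : v ∈ aStar) :
    pullback a w x v = x :=
  dif_neg fun ⟨y, hy⟩ => Finset.disjoint_left.1 (hP.disjoint_star y) hy hv

lemma pullback_eq_of_adj_star (hP : IsAggregationPartition G Γ M H a aStar)
    {w : Fin (n + 2) × Fin (m + 2) → ℝ} {x : ℝ} (hw : ∀ i, w (i, Fin.last _) = x) {v v' : V}
    (hv : v ∈ aStar) (hvv' : G.Adj v v') : pullback a w x v' = x := by
  rcases hP.star_neighbors v hv v' hvv' with h | ⟨i, j, hj, h⟩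
  · exact hP.pullback_of_mem_star w x h
  · obtain rfl : j = Fin.last _ := Fin.ext (by simpa using hj)
    rw [hP.pullback_of_mem w x h, hw]

variable [Fintype V]

lemma sum_le_mul_sum_blocks (hP : IsAggregationPartition G Γ M H a aStar) {g : V → ℝ}
    {κ : Fin (n + 2) × Fin (m + 2) → ℝ} (hκ : ∀ y, 0 ≤ κ y) (hgstar : ∀ v ∈ aStar, g v ≤ 0)
    (hg : ∀ y, ∀ v ∈ a y, g v ≤ κ y) : ∑ v, g v ≤ M * ∑ y, κ y := by
  classical
  have huniv : (Finset.univ : Finset V) = aStar ∪ Finset.univ.biUnion a := by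
    ext v
    simpa using hP.cover v
  have hdisj : Disjoint aStar (Finset.univ.biUnion a) :=
    (Finset.disjoint_biUnion_right _ _ _).2 fun y _ => (hP.disjoint_star y).symm
  rw [huniv, Finset.sum_union hdisj, Finset.sum_biUnion (hP.pairwise_disjoint.set_pairwise _),
    Finset.mul_sum]
  refine (add_le_of_nonpos_left (Finset.sum_nonpos hgstar)).trans
    (Finset.sum_le_sum fun y _ => ?_)
  calc ∑ v ∈ a y, g v ≤ (a y).card • κ y := Finset.sum_le_card_nsmul _ _ _ (hg y)
    _ ≤ M * κ y := by
        rw [nsmul_eq_mul]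
        gcongr
        · exact hκ y
        · exact hP.card_le y

variable [DecidableRel G.Adj]

lemma dirichlet_pullback_le [DecidableRel (gridStar (n + 2) (m + 2)).Adj]
    (hP : IsAggregationPartition G Γ M H a aStar) (hstar : H ≤ gridStar (n + 2) (m + 2))
    {w : Fin (n + 2) × Fin (m + 2) → ℝ} {x : ℝ} (hw : ∀ i, w (i, Fin.last _) = x) :
    dirichlet G (pullback a w x) ≤ M ^ 2 * dirichlet (gridStar (n + 2) (m + 2)) w := by
  set f := pullback a w x with hf
  have hκ (y z : Fin (n + 2) × Fin (m + 2)) :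
      0 ≤ if (gridStar (n + 2) (m + 2)).Adj y z then (w y - w z) ^ 2 else 0 :=
    ite_adj_nonneg w y z
  have hstar_left {v v' : V} (hv : v ∈ aStar) :
      (if G.Adj v v' then (f v - f v') ^ 2 else 0) = 0 := by
    refine ite_eq_right_iff.2 fun h => ?_
    rw [hf, hP.pullback_of_mem_star w x hv, hP.pullback_eq_of_adj_star hw hv h]
    ring
  have hstar_right {v v' : V} (hv' : v' ∈ aStar) :
      (if G.Adj v v' then (f v - f v') ^ 2 else 0) = 0 := by
    simpa only [G.adj_comm v', sub_sq_comm (f v')] using hstar_left (v' := v) hv'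
  have hblocks {y z : Fin (n + 2) × Fin (m + 2)} {v v' : V} (hv : v ∈ a y) (hv' : v' ∈ a z) :
      (if G.Adj v v' then (f v - f v') ^ 2 else 0) ≤
        if (gridStar (n + 2) (m + 2)).Adj y z then (w y - w z) ^ 2 else 0 := by
    rw [hf, hP.pullback_of_mem w x hv, hP.pullback_of_mem w x hv']
    rcases eq_or_ne y z with rfl | hyz
    · simp
    · split_ifs with hvv' hadj hadj
      · rfl
      · exact absurd (hstar ((hP.adj_iff y z hyz).2 ⟨v, hv, v', hv', hvv'⟩)) hadj
      · positivity
      · rfl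
  rw [sq, mul_assoc]
  unfold dirichlet blockForm
  rw [Finset.mul_sum]
  refine hP.sum_le_mul_sum_blocks (fun y => mul_nonneg (Nat.cast_nonneg M)
    (Finset.sum_nonneg fun z _ => hκ y z)) (fun v hv => ?_) fun y v hv => ?_
  · exact (Finset.sum_eq_zero fun v' _ => hstar_left hv).le
  · exact hP.sum_le_mul_sum_blocks (hκ y) (fun v' hv' => (hstar_right hv').le)
      fun z v' hv' => hblocks hv hv'

lemma degree_le (hP : IsAggregationPartition G Γ M H a aStar)
    (hstar : H ≤ gridStar (n + 2) (m + 2)) {v : V} {i : Fin (n + 2)} (hv : v ∈ a (i, 0)) :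
    G.degree v ≤ 6 * M := by
  classical
  let Y : Finset (Fin (n + 2) × Fin (m + 2)) :=
    Finset.univ.image fun e : Fin 3 × Fin 2 => (i + ![0, 1, -1] e.1, ![0, 1] e.2)
  have hY : Y.card ≤ 6 := Finset.card_image_le
  have hsub : G.neighborFinset v ⊆ Y.biUnion a := by
    intro w hw
    have hvw : G.Adj v w := (SimpleGraph.mem_neighborFinset _ _ _).1 hw
    have hw_star : w ∉ aStar := fun hw_star => by
      rcases hP.star_neighbors w hw_star v hvw.symm with hv' | ⟨i', j', hj, hv'⟩
      · exact Finset.disjoint_left.1 (hP.disjoint_star _) hv hv'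
      · have hrow : (0 : Fin (m + 2)) = j' := congrArg Prod.snd (hP.eq_of_mem hv hv')
        rw [← hrow] at hj
        simp at hj
    obtain ⟨y, hy⟩ := (hP.cover w).resolve_left hw_star
    refine Finset.mem_biUnion.2 ⟨y, Finset.mem_image.2 ?_, hy⟩
    rcases eq_or_ne (i, 0) y with rfl | hne
    · exact ⟨(0, 0), Finset.mem_univ _, by simp⟩
    have hadj := hstar ((hP.adj_iff _ _ hne).2 ⟨v, hv, w, hy, hvw⟩)
    obtain ⟨δ, hδ⟩ := fst_eq_of_gridStar_adj hadj
    obtain ⟨ε, hε⟩ : ∃ ε : Fin 2, y.2 = ![0, 1] ε := by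
      rcases snd_eq_of_gridStar_adj hadj with h | ⟨k, ⟨hk, h⟩ | ⟨-, hk⟩⟩
      · exact ⟨0, h⟩
      · obtain rfl : k = 0 := Fin.ext (congrArg Fin.val hk).symm
        exact ⟨1, h⟩
      · exact absurd hk.symm (Fin.succ_ne_zero k)
    exact ⟨(δ, ε), Finset.mem_univ _, Prod.ext hδ.symm hε.symm⟩
  calc G.degree v ≤ (Y.biUnion a).card := Finset.card_le_card hsub
    _ ≤ Y.card * M := Finset.card_biUnion_le_card_mul _ _ _ fun y _ => hP.card_le y
    _ ≤ 6 * M := Nat.mul_le_mul_right M hY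

lemma dirichlet_le_of_eq_zero_off_boundary (hP : IsAggregationPartition G Γ M H a aStar)
    (hstar : H ≤ gridStar (n + 2) (m + 2)) (hC : ∀ v ∈ Γ, v ∈ a (C v, 0)) {g : V → ℝ}
    (hg : ∀ v ∉ Γ, g v = 0) : dirichlet G g ≤ 24 * M * ∑ p : {v // v ∈ Γ}, g p ^ 2 := by
  calc dirichlet G g ≤ 4 * ∑ v, G.degree v * g v ^ 2 := dirichlet_le_degree g
    _ = 4 * ∑ p : {v // v ∈ Γ}, G.degree p * g p ^ 2 := by
        rw [Finset.sum_coe_sort Γ fun v => (G.degree v : ℝ) * g v ^ 2,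
          Finset.sum_subset (Finset.subset_univ Γ) fun v _ hv => by simp [hg v hv]]
    _ ≤ 4 * ∑ p : {v // v ∈ Γ}, ((6 * M : ℕ) : ℝ) * g p ^ 2 := by
        gcongr with p
        exact hP.degree_le hstar (hC p p.2)
    _ = 24 * M * ∑ p : {v // v ∈ Γ}, g p ^ 2 := by
        rw [← Finset.mul_sum]
        push_cast
        ring

end IsAggregationPartition

end Pullback

lemma card_mul_sum_sq_sub_mean_le {ι : Type*} [Fintype ι] (ψ : ι → ℝ) :
    Fintype.card ι * ∑ i, (ψ i - (∑ j, ψ j) / Fintype.card ι) ^ 2 ≤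
      ∑ i, ∑ j, (ψ i - ψ j) ^ 2 := by
  rw [Finset.mul_sum]
  refine Finset.sum_le_sum fun i _ => ?_
  have hcard : (0 : ℝ) < Fintype.card ι := Nat.cast_pos.2 (Fintype.card_pos_iff.2 ⟨i⟩)
  have hsum : ∑ j, (ψ i - ψ j) = Fintype.card ι * (ψ i - (∑ j, ψ j) / Fintype.card ι) := by
    rw [Finset.sum_sub_distrib, Finset.sum_const, Finset.card_univ, nsmul_eq_mul]
    field_simp
  have hcauchy := sq_sum_le_card_mul_sum_sq (s := Finset.univ) (f := fun j => ψ i - ψ j)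
  rw [hsum, mul_pow, sq, mul_assoc, Finset.card_univ] at hcauchy
  exact le_of_mul_le_mul_left hcauchy hcard

section CylinderForm

variable {n m : ℕ}

lemma dirichlet_cylinderExtension_le [DecidableRel (gridStar (n + 2) (m + 2)).Adj]
    (ψ : Fin (n + 2) → ℝ) (x : ℝ) :
    dirichlet (gridStar (n + 2) (m + 2)) (fun y => cylinderExtension ψ 1 x (m + 1) y.1 y.2) ≤
      10 * (2 * shiftForm ψ 1 (m + 2) + 2 / (m + 1) * ∑ i, (ψ i - x) ^ 2) := by
  have hhorizontal := cylinderExtension_horizontal ψ 1 x (m + 1)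
  have hvertical := cylinderExtension_vertical ψ 1 x (m + 1)
  have hmono := shiftForm_mono ψ 1 (Nat.le_succ (m + 1))
  rw [Finset.sum_range] at hhorizontal hvertical
  push_cast at hvertical
  refine (dirichlet_gridStar_le _).trans ?_
  simp only [Fin.val_succ, Fin.val_castSucc]
  linarith

end CylinderForm

section BoundaryForm

variable {V : Type*} {G : SimpleGraph V} {Γ : Finset V} {ι : Type*} [Fintype ι]

lemma sum_sq_sub_div_le_boundaryForm (hΓ : (G.induce {v | v ∈ Γ}).Preconnected)
    {p q : ι → {v // v ∈ Γ}} (hpq : Function.Injective fun i => (p i, q i)) {κ : ι → ℕ}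
    (hκ : ∀ i, (G.induce {v | v ∈ Γ}).dist (p i) (q i) ≤ κ i) (φ : {v // v ∈ Γ} → ℝ) :
    ∑ i, (φ (p i) - φ (q i)) ^ 2 / (κ i : ℝ) ^ 2 ≤ boundaryForm G Γ φ := by
  calc ∑ i, (φ (p i) - φ (q i)) ^ 2 / (κ i : ℝ) ^ 2
      ≤ ∑ i, ((((G.induce {v | v ∈ Γ}).dist (p i) (q i) : ℕ) : ℝ) ^ 2)⁻¹ *
          (φ (p i) - φ (q i)) ^ 2 := by
        refine Finset.sum_le_sum fun i _ => ?_
        rcases Nat.eq_zero_or_pos ((G.induce {v | v ∈ Γ}).dist (p i) (q i)) with h | h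
        · simp [(hΓ (p i) (q i)).dist_eq_zero_iff.1 h]
        · rw [div_eq_inv_mul]
          gcongr
          exact hκ i
    _ ≤ boundaryForm G Γ φ := by
        rw [boundaryForm, ← Fintype.sum_prod_type']
        exact sum_comp_le_of_injective hpq
          (g := fun x => ((((G.induce {v | v ∈ Γ}).dist x.1 x.2 : ℕ) : ℝ) ^ 2)⁻¹ *
            (φ x.1 - φ x.2) ^ 2) fun _ => by positivity

variable {n M : ℕ} {C : V → Fin (n + 2)} {r : Fin (n + 2) → {v // v ∈ Γ}}

lemma shiftForm_le_boundaryForm (hΓ : (G.induce {v | v ∈ Γ}).Preconnected)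
    (hdist : ∀ (p q : {v // v ∈ Γ}) (t : ℕ), C q = C p + t • 1 →
      (G.induce {v | v ∈ Γ}).dist p q < M * (t + 1))
    (hr : ∀ i, C (r i) = i) {N : ℕ} (hN : N < n + 2) (φ : {v // v ∈ Γ} → ℝ) :
    shiftForm (fun i => φ (r i)) 1 N ≤ 4 * M ^ 2 * boundaryForm G Γ φ := by
  have hM : 0 < M := by simpa using hdist (r 0) (r 0) 0
  have hrinj : Function.Injective r := fun i j h => by rw [← hr i, h, hr j]
  have hpairs : Function.Injective fun y : Fin N × Fin (n + 2) =>
      (r (y.2 + ((y.1 : ℕ) + 1) • 1), r y.2) := by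
    rintro ⟨t, i⟩ ⟨t', i'⟩ h
    obtain ⟨h, hi⟩ := Prod.ext_iff.1 h
    obtain rfl := hrinj hi
    have ht := congrArg Fin.val (add_left_cancel (hrinj h))
    rw [val_nsmul_one, val_nsmul_one, Nat.mod_eq_of_lt (by omega), Nat.mod_eq_of_lt (by omega)]
      at ht
    exact Prod.ext (Fin.ext (Nat.succ_injective ht)) rfl
  have hκ (y : Fin N × Fin (n + 2)) : (G.induce {v | v ∈ Γ}).dist
      (r (y.2 + ((y.1 : ℕ) + 1) • 1)) (r y.2) ≤ 2 * M * (y.1 + 1) := by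
    rw [SimpleGraph.dist_comm]
    have := hdist (r y.2) (r (y.2 + ((y.1 : ℕ) + 1) • 1)) (y.1 + 1) (by rw [hr, hr])
    nlinarith
  calc shiftForm (fun i => φ (r i)) 1 N
      = 4 * M ^ 2 * ∑ y : Fin N × Fin (n + 2), (φ (r (y.2 + ((y.1 : ℕ) + 1) • 1)) - φ (r y.2)) ^ 2 /
          ((2 * M * (y.1 + 1) : ℕ) : ℝ) ^ 2 := by
        rw [shiftForm, Finset.sum_range, Fintype.sum_prod_type, Finset.mul_sum]
        refine Finset.sum_congr rfl fun t _ => ?_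
        rw [shiftSq, Finset.sum_div, Finset.mul_sum]
        refine Finset.sum_congr rfl fun i _ => ?_
        push_cast
        field_simp
        norm_num
    _ ≤ 4 * M ^ 2 * boundaryForm G Γ φ := by
        gcongr
        exact sum_sq_sub_div_le_boundaryForm hΓ hpairs hκ φ

lemma sum_sq_sub_mean_le_boundaryForm (hΓ : (G.induce {v | v ∈ Γ}).Preconnected)
    (hdist : ∀ (p q : {v // v ∈ Γ}) (t : ℕ), C q = C p + t • 1 →
      (G.induce {v | v ∈ Γ}).dist p q < M * (t + 1))
    (hr : ∀ i, C (r i) = i) (φ : {v // v ∈ Γ} → ℝ) :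
    ∑ i, (φ (r i) - (∑ j, φ (r j)) / (n + 2)) ^ 2 ≤
      M ^ 2 * (n + 2) * boundaryForm G Γ φ := by
  have hM : 0 < M := by simpa using hdist (r 0) (r 0) 0
  have hrinj : Function.Injective r := fun i j h => by rw [← hr i, h, hr j]
  have hκ (y : Fin (n + 2) × Fin (n + 2)) :
      (G.induce {v | v ∈ Γ}).dist (r y.1) (r y.2) ≤ M * (n + 2) :=
    (hdist (r y.1) (r y.2) (y.2 - y.1).val
      (by rw [hr, hr, add_val_sub_nsmul_one])).le.trans (Nat.mul_le_mul_left M (y.2 - y.1).2)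
  have hpairs := sum_sq_sub_div_le_boundaryForm hΓ (hrinj.prodMap hrinj) hκ φ
  have hmean := card_mul_sum_sq_sub_mean_le fun i => φ (r i)
  rw [← Finset.sum_div, div_le_iff₀ (by positivity), Fintype.sum_prod_type] at hpairs
  simp only [Fintype.card_fin] at hmean hpairs
  push_cast at hmean hpairs
  refine le_of_mul_le_mul_left (hmean.trans (hpairs.trans_eq ?_)) (by positivity : (0 : ℝ) < n + 2)
  ring

lemma sum_sq_sub_representative_le_boundaryForm (hΓ : (G.induce {v | v ∈ Γ}).Preconnected)
    (hdist : ∀ (p q : {v // v ∈ Γ}) (t : ℕ), C q = C p + t • 1 →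
      (G.induce {v | v ∈ Γ}).dist p q < M * (t + 1))
    (hr : ∀ i, C (r i) = i) (φ : {v // v ∈ Γ} → ℝ) :
    ∑ p : {v // v ∈ Γ}, (φ p - φ (r (C p))) ^ 2 ≤ M ^ 2 * boundaryForm G Γ φ := by
  have hκ (p : {v // v ∈ Γ}) : (G.induce {v | v ∈ Γ}).dist p (r (C p)) ≤ M := by
    simpa using (hdist p (r (C p)) 0 (by rw [hr, zero_nsmul, add_zero])).le
  have hM : 0 < M := by simpa using hdist (r 0) (r 0) 0
  have h := sum_sq_sub_div_le_boundaryForm hΓ (p := fun p => p)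
    (fun p q h => congrArg Prod.fst h) hκ φ
  rwa [← Finset.sum_div, div_le_iff₀' (by positivity)] at h

end BoundaryForm

namespace IsAggregationPartition

variable {V : Type*} {G : SimpleGraph V} {Γ : Finset V} {M n m : ℕ}
  {H : SimpleGraph (Fin (n + 2) × Fin (m + 2))} {a : Fin (n + 2) × Fin (m + 2) → Finset V}
  {aStar : Finset V} {C : V → Fin (n + 2)}

variable [Fintype V] [DecidableRel G.Adj]

lemma exists_extension_of_first_row (hP : IsAggregationPartition G Γ M H a aStar)
    (hstar : H ≤ gridStar (n + 2) (m + 2)) (ψ : Fin (n + 2) → ℝ) (x : ℝ) :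
    ∃ f : V → ℝ, (∀ i, ∀ v ∈ a (i, 0), f v = ψ i) ∧ dirichlet G f ≤
      M ^ 2 * (10 * (2 * shiftForm ψ 1 (m + 2) + 2 / (m + 1) * ∑ i, (ψ i - x) ^ 2)) := by
  classical
  let w (y : Fin (n + 2) × Fin (m + 2)) : ℝ := cylinderExtension ψ 1 x (m + 1) y.1 y.2
  have hwlast (i : Fin (n + 2)) : w (i, Fin.last _) = x := by
    simpa [w] using cylinderExtension_last ψ 1 x m.succ_ne_zero i
  refine ⟨pullback a w x, fun i v hv => ?_, (hP.dirichlet_pullback_le hstar hwlast).trans ?_⟩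
  · rw [hP.pullback_of_mem w x hv]
    exact cylinderExtension_zero ψ 1 x (m + 1) i
  · gcongr
    exact dirichlet_cylinderExtension_le ψ x

lemma exists_boundary_correction (hP : IsAggregationPartition G Γ M H a aStar)
    (hstar : H ≤ gridStar (n + 2) (m + 2)) (hC : ∀ v ∈ Γ, v ∈ a (C v, 0)) (f : V → ℝ)
    (φ : {v // v ∈ Γ} → ℝ) :
    ∃ u : V → ℝ, (∀ p : {v // v ∈ Γ}, u p = φ p) ∧
      dirichlet G u ≤ 2 * dirichlet G f + 48 * M * ∑ p, (φ p - f p) ^ 2 := by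
  classical
  let u (v : V) : ℝ := if h : v ∈ Γ then φ ⟨v, h⟩ else f v
  have huΓ (p : {v // v ∈ Γ}) : u p = φ p := dif_pos p.2
  have hu := hP.dirichlet_le_of_eq_zero_off_boundary hstar hC (g := fun v => u v - f v)
    fun v hv => by simp only [u, dif_neg hv, sub_self]
  simp only [huΓ] at hu
  exact ⟨u, huΓ, by linarith [dirichlet_le_add_sub (G := G) u f]⟩

theorem exists_extension (hP : IsAggregationPartition G Γ M H a aStar)
    (hstar : H ≤ gridStar (n + 2) (m + 2)) (hC : ∀ v ∈ Γ, v ∈ a (C v, 0))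
    (hΓ : (G.induce {v | v ∈ Γ}).Preconnected)
    (hdist : ∀ (p q : {v // v ∈ Γ}) (t : ℕ), C q = C p + t • 1 →
      (G.induce {v | v ∈ Γ}).dist p q < M * (t + 1))
    (hmn : m < n) {c : ℕ} (hc : n + 2 < 2 * c * (m + 2)) (φ : {v // v ∈ Γ} → ℝ) :
    ∃ u : V → ℝ, (∀ p : {v // v ∈ Γ}, u p = φ p) ∧
      dirichlet G u ≤ (160 * c + 208) * M ^ 4 * boundaryForm G Γ φ := by
  choose s hsΓ hs using hP.exists_mem_column hC
  let r (i : Fin (n + 2)) : {v // v ∈ Γ} := ⟨s i, hsΓ i⟩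
  let x : ℝ := (∑ i, φ (r i)) / (n + 2)
  obtain ⟨f, hf₀, hf⟩ := hP.exists_extension_of_first_row hstar (fun i => φ (r i)) x
  obtain ⟨u, huΓ, hu⟩ := hP.exists_boundary_correction hstar hC f φ
  set Q := boundaryForm G Γ φ
  have hQ : 0 ≤ Q := boundaryForm_nonneg G Γ φ
  have hM : (1 : ℝ) ≤ M := by exact_mod_cast hP.one_le_bound
  have hshift := shiftForm_le_boundaryForm hΓ hdist hs (r := r) (N := m + 2) (by omega) φ
  have hmean : 2 / ((m : ℝ) + 1) * ∑ i, (φ (r i) - x) ^ 2 ≤ 8 * c * M ^ 2 * Q := by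
    have hnc : (n : ℝ) + 2 ≤ 4 * c * (m + 1) := by
      exact_mod_cast show n + 2 ≤ 4 * c * (m + 1) by nlinarith
    calc 2 / ((m : ℝ) + 1) * ∑ i, (φ (r i) - x) ^ 2
        ≤ 2 / ((m : ℝ) + 1) * (M ^ 2 * (4 * c * (m + 1)) * Q) := by
          gcongr
          exact (sum_sq_sub_mean_le_boundaryForm hΓ hdist hs φ).trans (by gcongr)
      _ = 8 * c * M ^ 2 * Q := by
          field_simp
          ring
  have hcorrection : ∑ p : {v // v ∈ Γ}, (φ p - f p) ^ 2 ≤ M ^ 2 * Q := by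
    simp only [fun p : {v // v ∈ Γ} => hf₀ (C p) p (hC p p.2)]
    exact sum_sq_sub_representative_le_boundaryForm hΓ hdist hs φ
  refine ⟨u, huΓ, ?_⟩
  calc dirichlet G u
      ≤ 2 * (M ^ 2 * (10 * (2 * (4 * M ^ 2 * Q) + 8 * c * M ^ 2 * Q))) +
          48 * M * (M ^ 2 * Q) := hu.trans (by gcongr; exact hf.trans (by gcongr))
    _ = 160 * c * M ^ 4 * Q + 160 * M ^ 4 * Q + 48 * M ^ 3 * Q := by ring
    _ ≤ 160 * c * M ^ 4 * Q + 160 * M ^ 4 * Q + 48 * M ^ 4 * Q := by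
        gcongr
        norm_num
    _ = (160 * c + 208) * M ^ 4 * Q := by ring

end IsAggregationPartition

section Minimum

variable {V : Type*} [Fintype V] {G : SimpleGraph V} [DecidableRel G.Adj]

lemma dirichlet_le_of_abs_sub_le {u u' : V → ℝ} (h : ∀ v w, |u v - u w| ≤ |u' v - u' w|) :
    dirichlet G u ≤ dirichlet G u' := by
  refine Finset.sum_le_sum fun v _ => Finset.sum_le_sum fun w _ => ?_
  split_ifs
  · exact sq_le_sq.2 (h v w)
  · exact le_rfl

lemma continuous_dirichlet : Continuous fun u : V → ℝ => dirichlet G u := by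
  refine continuous_finsetSum _ fun v _ => continuous_finsetSum _ fun w _ => ?_
  split_ifs <;> fun_prop

theorem exists_dirichlet_minimizer (Γ : Finset V) (φ : {v // v ∈ Γ} → ℝ) :
    ∃ u : V → ℝ, (∀ p : {v // v ∈ Γ}, u p = φ p) ∧
      ∀ u' : V → ℝ, (∀ p : {v // v ∈ Γ}, u' p = φ p) → dirichlet G u ≤ dirichlet G u' := by
  classical
  -- Clamping to `[-B, B]` does not increase the energy, so the minimum is sought in a compact set.
  let B := ∑ p, |φ p|
  have hφ (p : {v // v ∈ Γ}) : φ p ∈ Set.Icc (-B) B :=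
    abs_le.1 (Finset.single_le_sum (f := fun p => |φ p|) (fun p _ => abs_nonneg _)
      (Finset.mem_univ p))
  have hB : -B ≤ B := neg_le_self (Finset.sum_nonneg fun p _ => abs_nonneg _)
  let K : Set (V → ℝ) := (Set.univ.pi fun _ => Set.Icc (-B) B) ∩
    ⋂ p : {v // v ∈ Γ}, {u | u p = φ p}
  have hK : IsCompact K := (isCompact_univ_pi fun _ => isCompact_Icc).inter_right
    (isClosed_iInter fun p => isClosed_eq (continuous_apply _) continuous_const)
  have hclamp {u : V → ℝ} (hu : ∀ p : {v // v ∈ Γ}, u p = φ p) :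
      (fun v => (Set.projIcc (-B) B hB (u v) : ℝ)) ∈ K := by
    refine ⟨fun v _ => Subtype.coe_prop _, Set.mem_iInter.2 fun p => ?_⟩
    simp only [Set.mem_ofPred_eq, hu p, Set.projIcc_of_mem hB (hφ p)]
  have hne : K.Nonempty :=
    ⟨_, hclamp (u := fun v => if h : v ∈ Γ then φ ⟨v, h⟩ else 0) fun p => dif_pos p.2⟩
  obtain ⟨u, huK, hu⟩ := hK.exists_isMinOn hne (continuous_dirichlet (G := G)).continuousOn
  refine ⟨u, Set.mem_iInter.1 huK.2, fun u' hu' => (hu (hclamp hu')).trans ?_⟩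
  refine dirichlet_le_of_abs_sub_le fun v w => ?_
  simpa only [NNReal.coe_one, one_mul, Subtype.dist_eq, Real.dist_eq] using
    (LipschitzWith.projIcc hB).dist_le_mul (u' v) (u' w)

theorem exists_isLeast_energy [DecidableEq V] (Γ : Finset V) (φ : {v // v ∈ Γ} → ℝ) :
    ∃ u : V → ℝ, (∀ p : {v // v ∈ Γ}, u p = φ p) ∧
      IsLeast {r : ℝ | ∃ u : V → ℝ, (∀ p : {v // v ∈ Γ}, u p = φ p) ∧ r = energy G u}
        (energy G u) := by
  obtain ⟨u, hu, hmin⟩ := exists_dirichlet_minimizer (G := G) Γ φ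
  refine ⟨u, hu, ⟨u, hu, rfl⟩, ?_⟩
  rintro _ ⟨w, hw, rfl⟩
  rw [energy_eq_sqrt_dirichlet, energy_eq_sqrt_dirichlet]
  gcongr
  exact hmin w hw

end Minimum

section EnergyBounds

variable {V : Type*} [Fintype V] [DecidableEq V] {G : SimpleGraph V} [DecidableRel G.Adj]
  {Γ : Finset V} {M c : ℕ} {φ : {v // v ∈ Γ} → ℝ} {u : V → ℝ}

lemma sqrt_boundaryLaplacian_le_energy {X : ℝ} (hX : 0 < X) (hM : 1 ≤ M)
    (h : boundaryForm G Γ φ ≤ 36 * M ^ 3 * X ^ 2 * dirichlet G u) :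
    1 / (6 * (M : ℝ) * √((M : ℝ) + 3) * X) * √((boundaryLaplacian G Γ *ᵥ φ) ⬝ᵥ φ) ≤
      energy G u := by
  have : (0 : ℝ) < M := by exact_mod_cast hM
  have hu : 0 ≤ dirichlet G u := dirichlet_nonneg u
  rw [boundaryLaplacian_mulVec_dotProduct, energy_eq_sqrt_dirichlet, one_div,
    inv_mul_le_iff₀ (by positivity)]
  refine Real.sqrt_le_iff.2 ⟨by positivity, ?_⟩
  calc boundaryForm G Γ φ / 2 ≤ 36 * M ^ 2 * M * X ^ 2 * (dirichlet G u / 2) := by linarith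
    _ ≤ 36 * M ^ 2 * (M + 3) * X ^ 2 * (dirichlet G u / 2) := by
        gcongr
        linarith
    _ = (6 * M * √(M + 3) * X * √(dirichlet G u / 2)) ^ 2 := by
        simp only [mul_pow, Real.sq_sqrt (show (0 : ℝ) ≤ M + 3 by positivity),
          Real.sq_sqrt (show 0 ≤ dirichlet G u / 2 by positivity)]
        norm_num

lemma energy_le_sqrt_boundaryLaplacian
    (h : dirichlet G u ≤ (160 * c + 208) * M ^ 4 * boundaryForm G Γ φ) :
    energy G u ≤
      28 * (M : ℝ) ^ 2 * √(3 * (c : ℝ) + 20) * √((boundaryLaplacian G Γ *ᵥ φ) ⬝ᵥ φ) := by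
  have hQ := boundaryForm_nonneg G Γ φ
  rw [boundaryLaplacian_mulVec_dotProduct, energy_eq_sqrt_dirichlet]
  refine Real.sqrt_le_iff.2 ⟨by positivity, ?_⟩
  calc dirichlet G u / 2 ≤ (160 * c + 208) * M ^ 4 * (boundaryForm G Γ φ / 2) := by linarith
    _ ≤ 28 ^ 2 * (3 * c + 20) * M ^ 4 * (boundaryForm G Γ φ / 2) := by
        gcongr
        linarith [c.cast_nonneg (α := ℝ)]
    _ = (28 * M ^ 2 * √(3 * c + 20) * √(boundaryForm G Γ φ / 2)) ^ 2 := by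
        simp only [mul_pow, Real.sq_sqrt (show (0 : ℝ) ≤ 3 * c + 20 by positivity),
          Real.sq_sqrt (show 0 ≤ boundaryForm G Γ φ / 2 by positivity)]
        ring

end EnergyBounds

lemma IsThreeConnected.preconnected {V : Type*} {G : SimpleGraph V} (h : IsThreeConnected G) :
    G.Preconnected := by
  have hempty := (h ∅ (by simp)).preconnected
  rw [show {v : V | v ∉ (∅ : Finset V)} = Set.univ by ext; simp] at hempty
  exact (SimpleGraph.induceUnivIso G).preconnected_iff.1 hempty

end TraceGraph

theorem corollary3p4_general {V : Type*} [Fintype V] [DecidableEq V] {G : SimpleGraph V}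
    [DecidableRel G.Adj] (hG : G.Preconnected) {R : TraceGraph.RotationSystem G} (hR : R.IsPlanar)
    {Γ : Finset V} (hΓ : R.IsFaceVertexSet Γ) {k l c M : ℕ} (hl : 2 ≤ l) (hlk : l < k)
    (hkc : k < 2 * c * l) {H : SimpleGraph (Fin k × Fin l)} (hH : TraceGraph.IsMAggregation G Γ M H)
    (φ : {v // v ∈ Γ} → ℝ) :
    ∃ m : ℝ,
      IsLeast {r : ℝ | ∃ u : V → ℝ, (∀ p : {v // v ∈ Γ}, u p = φ p) ∧ r = TraceGraph.energy G u} m ∧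
      1 / (6 * (M : ℝ) * √((M : ℝ) + 3) * max (√(3 * (c : ℝ))) (2 * Real.pi)) *
        √((TraceGraph.boundaryLaplacian G Γ *ᵥ φ) ⬝ᵥ φ) ≤ m ∧
      m ≤ 28 * (M : ℝ) ^ 2 * √(3 * (c : ℝ) + 20) *
        √((TraceGraph.boundaryLaplacian G Γ *ᵥ φ) ⬝ᵥ φ) := by
  obtain ⟨hgrid, hstar, a, aStar, hP⟩ := hH
  obtain ⟨m, rfl⟩ := Nat.exists_eq_add_of_le' hl
  obtain ⟨n, rfl⟩ := Nat.exists_eq_add_of_le' (hl.trans hlk.le)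
  obtain ⟨C, hC⟩ := hP.exists_column
  have hdist := hP.dist_lt_of_column_eq_add hgrid hstar (by omega) hC hR hG hΓ
  obtain ⟨u, hu, hleast⟩ := TraceGraph.exists_isLeast_energy (G := G) Γ φ
  obtain ⟨w, hw, hwφ⟩ :=
    hP.exists_extension hstar hC hΓ.preconnected hdist (by omega) hkc φ
  refine ⟨TraceGraph.energy G u, hleast, ?_,
    (hleast.2 ⟨w, hw, rfl⟩).trans (TraceGraph.energy_le_sqrt_boundaryLaplacian hwφ)⟩
  set X := max (√(3 * (c : ℝ))) (2 * Real.pi)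
  have hX : 6 ≤ X := le_max_of_le_right (by linarith [Real.pi_gt_three])
  have hcX : 3 * (c : ℝ) ≤ X ^ 2 := Real.sqrt_le_iff.1 (le_max_left _ _) |>.2
  have htrace := hP.boundaryForm_le_dirichlet hgrid hstar hC hΓ.preconnected hkc hcX
    (by nlinarith) u
  simp only [hu] at htrace
  exact TraceGraph.sqrt_boundaryLaplacian_le_energy (by linarith) hP.one_le_bound htrace

theorem corollary3p4 {V : Type*} [Fintype V] [DecidableEq V]
    (G : SimpleGraph V) [DecidableRel G.Adj] (Γ : Finset V)
    (hG : TraceGraph.IsPlanarWithBoundary G Γ)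
    (k l c M : ℕ) (hl : 2 ≤ l) (hkl : 4 * l < k) (hkc : k < 2 * c * l)
    (H : SimpleGraph (Fin k × Fin l)) (hH : TraceGraph.IsMAggregation G Γ M H)
    (φ : {v // v ∈ Γ} → ℝ) :
    ∃ m : ℝ,
      IsLeast {r : ℝ | ∃ u : V → ℝ, (∀ p : {v // v ∈ Γ}, u p = φ p) ∧
        r = TraceGraph.energy G u} m ∧
      1 / (6 * (M : ℝ) * √((M : ℝ) + 3) * max (√(3 * (c : ℝ))) (2 * Real.pi)) *
        √((TraceGraph.boundaryLaplacian G Γ *ᵥ φ) ⬝ᵥ φ) ≤ m ∧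
      m ≤ 28 * (M : ℝ) ^ 2 * √(3 * (c : ℝ) + 20) *
        √((TraceGraph.boundaryLaplacian G Γ *ᵥ φ) ⬝ᵥ φ) := by
  obtain ⟨-, hconnected, R, hR, hΓ⟩ := hG
  exact corollary3p4_general hconnected.preconnected hR hΓ hl (by omega) hkc hH φ
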